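/- Let $N\in\mathbb N$, let $\mathbb T^3=\mathbb R^3/(2\pi\mathbb Z)^3$, and let $\mathcal E$ be the space of Hermitian $N\times N$ matrices with the norm $\|A\|^2=\operatorname{Tr}(A^2)$; write $\lambda_1(A)\le\dots\le\lambda_N(A)$ for the eigenvalues of $A\in\mathcal E$, repeated according to multiplicity. Equip $C^\infty(\mathbb T^3,\mathcal E)$ with the distance $$d(H,\widetilde H)=\sum_{k\ge 0}2^{-k}\,\frac{\|H-\widetilde H\|_{C^k}}{1+\|H-\widetilde H\|_{C^k}},\qquad \|H\|_{C^k}=\sup_{\xi\in\mathbb T^3}\big(\|H(\xi)\|+\|\nabla^kH(\xi)\|\big).$$ A *$\mathbb Z^3$-invariant Hamiltonian* is a bounded selfadjoint operator $\mathcal H$ on $\ell^2(\mathbb Z^3,\mathbb C^N)$ that commutes with all translations $(T_a\psi)_m=\psi_{m+a}$, $a\in\mathbb Z^3$, whose matrix coefficients $K(m,k)\in M_N(\mathbb C)$, $(\mathcal H\psi)_m=\sum_kK(m,k)\psi_k$, satisfy $\sum_k\|K(0,k)\|<\infty$, and whose Bloch transform $$H(\xi)=e^{-i\xi\cdot m}\,\mathcal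 H\,e^{i\xi\cdot m}=\sum_{k\in\mathbb Z^3}K(0,k)\,e^{i\xi\cdot k},\qquad \xi\in\mathbb T^3,$$ belongs to $C^\infty(\mathbb T^3,\mathcal E)$. The *Bloch eigenvalues* of $\mathcal H$ are the functions $\xi\mapsto\lambda_n(H(\xi))$. The set of all such Hamiltonians carries the distance $d$ of the Bloch transforms. The family $H$ has a *degeneracy* at $\xi_0$ if $H(\xi_0)$ has a repeated eigenvalue. The degeneracy is *conical* if for some $n\in\{1,\dots,N-1\}$: 1. $\lambda_n(H(\xi_0))=\lambda_{n+1}(H(\xi_0))$ and all other eigenvalues of $H(\xi_0)$ are simple; 2. there are an open neighbourhood $\Omega$ of $\xi_0$ and functions $\ell\in C^\infty(\Omega,\mathbb R)$, $q\in C^\infty(\Omega,[0,\infty))$, where $q(\xi_0)=0$ and $\xi_0$ is a non-degenerate critical point of $q$, such that for $\xi\in\Omega$ $$\lambda_n(H(\xi))=\ell(\xi)-\sqrt{q(\xi)},\qquad \lambda_{n+1}(H(\xi))=\ell(\xi)+\sqrt{q(\xi)}.$$ Then, for a generic $\mathbb Z^3$-invariant Hamiltonian on $\ell^2(\mathbb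 Z^3,\mathbb C^N)$, all degeneracies of the Bloch eigenvalues are conical: the set of $\mathbb Z^3$-invariant Hamiltonians all of whose Bloch degeneracies are conical is open and dense in the space of $\mathbb Z^3$-invariant Hamiltonians. -/

import Mathlib

open scoped ContDiff

attribute [local instance] Matrix.frobeniusNormedAddCommGroup Matrix.frobeniusNormedSpace

namespace BlochTheory

/-! ### Smooth families of Hermitian matrices over the three-dimensional torus -/

/-- Quasi-momenta. The torus `𝕋³ = ℝ³ / (2πℤ)³` is handled through its universal cover: functions
on `𝕋³` are the functions on `ℝ³` that are `2π`-periodic in each coordinate. -/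
abbrev Momentum : Type := EuclideanSpace ℝ (Fin 3)

/-- The vector `2π m` of the lattice `(2πℤ)³`. -/
noncomputable def period (m : Fin 3 → ℤ) : Momentum :=
  WithLp.toLp 2 fun i => 2 * Real.pi * (m i : ℝ)

/-- `C^∞(𝕋³, E)`, where `E` is the space of Hermitian `N × N` matrices, with the
norm `‖A‖² = Tr (A²)`. -/
structure SmoothFamily (N : ℕ) where
  toFun : Momentum → Matrix (Fin N) (Fin N) ℂ
  isHermitian : ∀ ξ, (toFun ξ).IsHermitian
  periodic : ∀ (m : Fin 3 → ℤ) (ξ : Momentum), toFun (ξ + period m) = toFun ξ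
  smooth : ContDiff ℝ ∞ toFun

/-- The eigenvalues of a Hermitian matrix, repeated according to multiplicity and listed in
nondecreasing order (Mathlib's `eigenvalues₀` lists them in nonincreasing order). -/
noncomputable def eigenvalue {N : ℕ} {A : Matrix (Fin N) (Fin N) ℂ} (hA : A.IsHermitian)
    (j : Fin N) : ℝ :=
  hA.eigenvalues₀ (Fin.cast (Fintype.card_fin N).symm j.rev)

/-- `q` has a non-degenerate critical point at `x`: its differential vanishes and its Hessian is
a non-degenerate bilinear form. -/
def IsNondegenerateCriticalPoint (q : Momentum → ℝ) (x : Momentum) : Prop :=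
  fderiv ℝ q x = 0 ∧
    ∀ v : Momentum, (∀ w : Momentum, fderiv ℝ (fderiv ℝ q) x v w = 0) → v = 0

namespace SmoothFamily

variable {N : ℕ}

/-- `λ_j(H(ξ))`, with `j = 0, …, N - 1`. -/
noncomputable def eigenvalueAt (H : SmoothFamily N) (j : Fin N) (ξ : Momentum) : ℝ :=
  eigenvalue (H.isHermitian ξ) j

/-- `H` has a degeneracy at `ξ`: the matrix `H(ξ)` has a repeated eigenvalue. -/
def HasDegeneracyAt (H : SmoothFamily N) (ξ : Momentum) : Prop :=
  ∃ j k : Fin N, j ≠ k ∧ H.eigenvalueAt j ξ = H.eigenvalueAt k ξ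

/-- `H` has a conical degeneracy at `ξ₀`: for some pair of consecutive indices `n`, `n' = n + 1`,
the eigenvalues `λ_n(H(ξ₀))` and `λ_{n+1}(H(ξ₀))` coincide, all other eigenvalues of `H(ξ₀)` are
simple, and near `ξ₀` one has `λ_n(H) = ℓ - √q`, `λ_{n+1}(H) = ℓ + √q` with `ℓ`, `q ≥ 0` smooth
and `q` having the non-degenerate critical value `0` at `ξ₀`. -/
def IsConicalAt (H : SmoothFamily N) (ξ₀ : Momentum) : Prop :=
  ∃ n n' : Fin N, (n' : ℕ) = n + 1 ∧
    H.eigenvalueAt n ξ₀ = H.eigenvalueAt n' ξ₀ ∧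
    (∀ j : Fin N, j ≠ n → j ≠ n' → ∀ k : Fin N, k ≠ j →
      H.eigenvalueAt k ξ₀ ≠ H.eigenvalueAt j ξ₀) ∧
    ∃ (Ω : Set Momentum) (ℓ q : Momentum → ℝ),
      IsOpen Ω ∧ ξ₀ ∈ Ω ∧ ContDiffOn ℝ ∞ ℓ Ω ∧ ContDiffOn ℝ ∞ q Ω ∧ (∀ ξ ∈ Ω, 0 ≤ q ξ) ∧
      q ξ₀ = 0 ∧ IsNondegenerateCriticalPoint q ξ₀ ∧
      ∀ ξ ∈ Ω, H.eigenvalueAt n ξ = ℓ ξ - √(q ξ) ∧ H.eigenvalueAt n' ξ = ℓ ξ + √(q ξ)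

/-! #### The metric of `C^∞(𝕋³, E)` -/

/-- The norm `‖F‖_{C^k} = sup_ξ (‖F(ξ)‖ + ‖∇^k F(ξ)‖)`, for the flat metric of `𝕋³`. -/
noncomputable def cNorm (k : ℕ) (F : Momentum → Matrix (Fin N) (Fin N) ℂ) : ℝ :=
  ⨆ ξ, (‖F ξ‖ + ‖iteratedFDeriv ℝ k F ξ‖)

theorem exists_period_add_mem (ξ : Momentum) :
    ∃ m : Fin 3 → ℤ, ξ + period m ∈ Metric.closedBall (0 : Momentum) 20 := by
  have h2 : (0 : ℝ) < 2 * Real.pi := by positivity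
  refine ⟨fun i => -toIcoDiv h2 0 (ξ i), ?_⟩
  have hb : ∀ i, 0 ≤ (ξ + period fun i => -toIcoDiv h2 0 (ξ i)) i ∧
      (ξ + period fun i => -toIcoDiv h2 0 (ξ i)) i ≤ 7 := by
    intro i
    have h := toIcoMod_mem_Ico h2 0 (ξ i)
    have e : (ξ + period fun i => -toIcoDiv h2 0 (ξ i)) i = toIcoMod h2 0 (ξ i) := by
      simp only [period, PiLp.add_apply, toIcoMod, zsmul_eq_mul]
      push_cast
      ring
    rw [e]
    have := Real.pi_lt_d2
    exact ⟨h.1, by linarith [h.2]⟩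
  rw [mem_closedBall_zero_iff, EuclideanSpace.norm_eq]
  apply Real.sqrt_le_iff.mpr
  refine ⟨by norm_num, ?_⟩
  simp only [Real.norm_eq_abs, sq_abs, Fin.sum_univ_three]
  nlinarith [hb 0, hb 1, hb 2]

theorem bddAbove_cNorm {F : Momentum → Matrix (Fin N) (Fin N) ℂ} (hF : ContDiff ℝ ∞ F)
    (hp : ∀ (m : Fin 3 → ℤ) (ξ : Momentum), F (ξ + period m) = F ξ) (k : ℕ) :
    BddAbove (Set.range fun ξ => ‖F ξ‖ + ‖iteratedFDeriv ℝ k F ξ‖) := by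
  have hc : Continuous fun ξ => ‖F ξ‖ + ‖iteratedFDeriv ℝ k F ξ‖ :=
    hF.continuous.norm.add (hF.continuous_iteratedFDeriv (by exact_mod_cast le_top)).norm
  obtain ⟨C, hC⟩ := (isCompact_closedBall (0 : Momentum) 20).bddAbove_image hc.continuousOn
  refine ⟨C, ?_⟩
  rintro _ ⟨ξ, rfl⟩
  obtain ⟨m, hm⟩ := exists_period_add_mem ξ
  have h := hC ⟨_, hm, rfl⟩
  have e : iteratedFDeriv ℝ k F (ξ + period m) = iteratedFDeriv ℝ k F ξ := by
    rw [← iteratedFDeriv_comp_add_right]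
    simp only [hp]
  simpa only [hp, e] using h

/-- `d(H, K) = ∑_k 2^{-k} ‖H - K‖_{C^k} / (1 + ‖H - K‖_{C^k})`. -/
noncomputable def distance (H K : SmoothFamily N) : ℝ :=
  ∑' k : ℕ, (1 / 2 : ℝ) ^ k *
    (cNorm k (H.toFun - K.toFun) / (1 + cNorm k (H.toFun - K.toFun)))

theorem cNorm_nonneg (k : ℕ) (F : Momentum → Matrix (Fin N) (Fin N) ℂ) : 0 ≤ cNorm k F :=
  Real.iSup_nonneg fun _ => by positivity

theorem bddAbove_sub (H K : SmoothFamily N) (k : ℕ) :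
    BddAbove (Set.range fun ξ => ‖(H.toFun - K.toFun) ξ‖ +
      ‖iteratedFDeriv ℝ k (H.toFun - K.toFun) ξ‖) :=
  bddAbove_cNorm (H.smooth.sub K.smooth)
    (fun m ξ => by simp [H.periodic, K.periodic]) k

theorem cNorm_triangle (H K L : SmoothFamily N) (k : ℕ) :
    cNorm k (H.toFun - L.toFun) ≤
      cNorm k (H.toFun - K.toFun) + cNorm k (K.toFun - L.toFun) := by
  refine ciSup_le fun ξ => ?_
  have h1 := le_ciSup (bddAbove_sub H K k) ξ
  have h2 := le_ciSup (bddAbove_sub K L k) ξ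
  have hk : ((k : ℕ∞) : WithTop ℕ∞) ≤ ∞ := by exact_mod_cast le_top
  have e : H.toFun - L.toFun = (H.toFun - K.toFun) + (K.toFun - L.toFun) := by abel
  have e2 : iteratedFDeriv ℝ k (H.toFun - L.toFun) ξ =
      iteratedFDeriv ℝ k (H.toFun - K.toFun) ξ + iteratedFDeriv ℝ k (K.toFun - L.toFun) ξ := by
    rw [e, iteratedFDeriv_add_apply]
    · exact ((H.smooth.sub K.smooth).of_le hk).contDiffAt
    · exact ((K.smooth.sub L.smooth).of_le hk).contDiffAt
  have h3 : ‖(H.toFun - L.toFun) ξ‖ ≤ ‖(H.toFun - K.toFun) ξ‖ + ‖(K.toFun - L.toFun) ξ‖ := by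
    rw [e]
    exact norm_add_le _ _
  have h4 := norm_add_le (iteratedFDeriv ℝ k (H.toFun - K.toFun) ξ)
    (iteratedFDeriv ℝ k (K.toFun - L.toFun) ξ)
  rw [← e2] at h4
  unfold cNorm
  linarith

theorem cNorm_comm (H K : SmoothFamily N) (k : ℕ) :
    cNorm k (H.toFun - K.toFun) = cNorm k (K.toFun - H.toFun) := by
  have e : H.toFun - K.toFun = -(K.toFun - H.toFun) := by abel
  unfold cNorm
  simp only [e, iteratedFDeriv_neg_apply, Pi.neg_apply, norm_neg]

theorem summable_distance (H K : SmoothFamily N) :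
    Summable fun k : ℕ => (1 / 2 : ℝ) ^ k *
      (cNorm k (H.toFun - K.toFun) / (1 + cNorm k (H.toFun - K.toFun))) := by
  refine Summable.of_nonneg_of_le (fun k => ?_) (fun k => ?_) summable_geometric_two
  · have := cNorm_nonneg k (H.toFun - K.toFun)
    positivity
  · have := cNorm_nonneg k (H.toFun - K.toFun)
    refine mul_le_of_le_one_right (by positivity) ?_
    rw [div_le_one (by positivity)]
    linarith

noncomputable instance : MetricSpace (SmoothFamily N) where
  dist := distance
  dist_self H := by
    have h : ∀ k, cNorm k (0 : Momentum → Matrix (Fin N) (Fin N) ℂ) = 0 := by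
      intro k
      have e : iteratedFDeriv ℝ k (0 : Momentum → Matrix (Fin N) (Fin N) ℂ) = 0 :=
        iteratedFDeriv_fun_zero
      simp [cNorm, e]
    simp [distance, h]
  dist_comm H K := by
    simp only [distance, cNorm_comm H K]
  dist_triangle H K L := by
    rw [distance, distance, distance,
      ← (summable_distance H K).tsum_add (summable_distance K L)]
    refine (summable_distance H L).tsum_le_tsum (fun k => ?_)
      ((summable_distance H K).add (summable_distance K L))
    rw [← mul_add]
    refine mul_le_mul_of_nonneg_left ?_ (by positivity)
    have h := cNorm_triangle H K L k
    have h1 := cNorm_nonneg k (H.toFun - L.toFun)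
    have h2 := cNorm_nonneg k (H.toFun - K.toFun)
    have h3 := cNorm_nonneg k (K.toFun - L.toFun)
    generalize cNorm k (H.toFun - L.toFun) = a at *
    generalize cNorm k (H.toFun - K.toFun) = b at *
    generalize cNorm k (K.toFun - L.toFun) = c at *
    calc a / (1 + a) ≤ (b + c) / (1 + (b + c)) := by
          rw [div_le_div_iff₀ (by positivity) (by positivity)]
          nlinarith
      _ = b / (1 + (b + c)) + c / (1 + (b + c)) := add_div _ _ _
      _ ≤ b / (1 + b) + c / (1 + c) := by
          gcongr <;> linarith
  eq_of_dist_eq_zero := by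
    intro H K h
    have h0 := (summable_distance H K).hasSum
    have hn : ∀ k : ℕ, 0 ≤ (1 / 2 : ℝ) ^ k *
        (cNorm k (H.toFun - K.toFun) / (1 + cNorm k (H.toFun - K.toFun))) := fun k => by
      have := cNorm_nonneg k (H.toFun - K.toFun)
      positivity
    change HasSum _ (distance H K) at h0
    rw [show distance H K = 0 from h, hasSum_zero_iff_of_nonneg hn] at h0
    have h1 := congrFun h0 0
    have h2 := cNorm_nonneg 0 (H.toFun - K.toFun)
    have h3 : cNorm 0 (H.toFun - K.toFun) = 0 := by
      have : (1 + cNorm 0 (H.toFun - K.toFun)) ≠ 0 := by positivity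
      simpa [this] using h1
    have e : H.toFun = K.toFun := by
      funext ξ
      have h4 := le_ciSup (bddAbove_sub H K 0) ξ
      change _ ≤ cNorm 0 (H.toFun - K.toFun) at h4
      rw [h3] at h4
      have h5 : ‖(H.toFun - K.toFun) ξ‖ = 0 :=
        le_antisymm (by linarith [norm_nonneg (iteratedFDeriv ℝ 0 (H.toFun - K.toFun) ξ)])
          (norm_nonneg _)
      exact sub_eq_zero.mp (norm_eq_zero.mp h5)
    cases H
    cases K
    cases e
    rfl

end SmoothFamily

/-! ### Translation-invariant Hamiltonians and their Bloch transform -/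

/-- The Hilbert space `ℓ²(ℤ³, ℂ^N)`. -/
abbrev StateSpace (N : ℕ) : Type :=
  lp (fun _ : Fin 3 → ℤ => EuclideanSpace ℂ (Fin N)) 2

variable {N : ℕ}

/-- The translation `(T_a ψ)_m = ψ_{m + a}` of `ℓ²(ℤ³, ℂ^N)`. -/
noncomputable def translation (a : Fin 3 → ℤ) (ψ : StateSpace N) : StateSpace N :=
  ⟨fun m => ψ (m + a), by
    have h2 : 0 < (2 : ENNReal).toReal := by norm_num
    have h := (lp.memℓp ψ).summable h2
    exact memℓp_gen (h.comp_injective (add_left_injective a))⟩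

/-- The matrix element `K(m, k)_{ij}`: the `i`-th component at the site `m` of `𝓗 (δ_k ⊗ e_j)`. -/
noncomputable def kernel (op : StateSpace N →L[ℂ] StateSpace N) (m k : Fin 3 → ℤ) :
    Matrix (Fin N) (Fin N) ℂ :=
  Matrix.of fun i j => (op (lp.single 2 k (EuclideanSpace.single j (1 : ℂ)))) m i

/-- The phase `e^{i ξ·k}`. -/
noncomputable def phase (ξ : Momentum) (k : Fin 3 → ℤ) : ℂ :=
  Complex.exp (Complex.I * ((∑ i, ξ i * (k i : ℝ) : ℝ) : ℂ))

/-- The matrix `H(ξ)` of the Bloch transform, that is, of `e^{-i ξ·m} 𝓗 e^{i ξ·m}`: its `j`-th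
column is the value at the site `0` of `𝓗` applied to the plane wave `(e^{i ξ·k} e_j)_k`, where
`𝓗` acts on bounded sequences through its kernel. See `kernel_planeWave` for the other sites. -/
noncomputable def blochMatrix (op : StateSpace N →L[ℂ] StateSpace N) (ξ : Momentum) :
    Matrix (Fin N) (Fin N) ℂ :=
  Matrix.of fun i j => ∑' k : Fin 3 → ℤ, kernel op 0 k i j * phase ξ k

/-- A `ℤ³`-translation-invariant Hamiltonian on `ℓ²(ℤ³, ℂ^N)`: a bounded selfadjoint operator
which commutes with the translations, whose Bloch transform is well defined (the matrix elements
are absolutely summable) and smooth. -/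
structure Hamiltonian (N : ℕ) where
  op : StateSpace N →L[ℂ] StateSpace N
  selfAdjoint : IsSelfAdjoint op
  invariant : ∀ (a : Fin 3 → ℤ) (ψ : StateSpace N),
    op (translation a ψ) = translation a (op ψ)
  summable : Summable fun k : Fin 3 → ℤ => ‖kernel op 0 k‖
  smooth : ContDiff ℝ ∞ (blochMatrix op)

namespace Hamiltonian

theorem translation_single (a k : Fin 3 → ℤ) (v : EuclideanSpace ℂ (Fin N)) :
    translation a (lp.single 2 k v : StateSpace N) = lp.single 2 (k - a) v := by
  ext m : 2
  change (lp.single 2 k v : StateSpace N) (m + a) = (lp.single 2 (k - a) v : StateSpace N) m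
  by_cases h : m + a = k
  · subst h
    simp
  · rw [lp.single_apply_ne _ _ _ h, lp.single_apply_ne]
    intro h'
    exact h (by simp [h'])

theorem kernel_add (A : Hamiltonian N) (m k a : Fin 3 → ℤ) :
    kernel A.op (m + a) (k + a) = kernel A.op m k := by
  ext i j
  have h := A.invariant a (lp.single 2 (k + a) (EuclideanSpace.single j (1 : ℂ)))
  rw [translation_single, add_sub_cancel_right] at h
  simp only [kernel, Matrix.of_apply]
  rw [h]
  rfl

theorem kernel_conjTranspose (A : Hamiltonian N) (m k : Fin 3 → ℤ) (i j : Fin N) :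
    star (kernel A.op m k i j) = kernel A.op k m j i := by
  have hs := (ContinuousLinearMap.isSelfAdjoint_iff_isSymmetric.mp A.selfAdjoint)
    (lp.single 2 m (EuclideanSpace.single i (1 : ℂ)))
    (lp.single 2 k (EuclideanSpace.single j (1 : ℂ)))
  simp only [ContinuousLinearMap.coe_coe] at hs
  rw [lp.inner_single_left, lp.inner_single_right, EuclideanSpace.inner_single_left,
    EuclideanSpace.inner_single_right] at hs
  have hs' := congrArg star hs
  simp only [map_one, one_mul, star_star, starRingEnd_apply] at hs'
  exact hs'.symm

theorem star_phase (ξ : Momentum) (k : Fin 3 → ℤ) : star (phase ξ k) = phase ξ (-k) := by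
  rw [phase, phase, ← starRingEnd_apply, ← Complex.exp_conj]
  congr 1
  simp

theorem phase_add (ξ : Momentum) (k m : Fin 3 → ℤ) :
    phase ξ (k + m) = phase ξ m * phase ξ k := by
  rw [phase, phase, phase, ← Complex.exp_add]
  congr 1
  simp only [Pi.add_apply, Int.cast_add, mul_add, Finset.sum_add_distrib, Complex.ofReal_add]
  ring

/-- Plane waves are mapped to plane waves: `𝓗 (e^{i ξ·k} e_j)_k = (e^{i ξ·m} H(ξ) e_j)_m`. -/
theorem kernel_planeWave (A : Hamiltonian N) (ξ : Momentum) (m : Fin 3 → ℤ) (i j : Fin N) :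
    ∑' k : Fin 3 → ℤ, kernel A.op m k i j * phase ξ k = phase ξ m * blochMatrix A.op ξ i j := by
  rw [← (Equiv.addRight m).tsum_eq, blochMatrix, Matrix.of_apply, ← tsum_mul_left]
  refine tsum_congr fun k => ?_
  have h := A.kernel_add 0 k m
  rw [zero_add] at h
  rw [Equiv.coe_addRight, h, phase_add]
  ring

theorem blochMatrix_isHermitian (A : Hamiltonian N) (ξ : Momentum) :
    (blochMatrix A.op ξ).IsHermitian := by
  ext i j
  rw [Matrix.conjTranspose_apply]
  simp only [blochMatrix, Matrix.of_apply]
  rw [tsum_star, ← (Equiv.neg (Fin 3 → ℤ)).tsum_eq]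
  refine tsum_congr fun k => ?_
  have h := A.kernel_add (-k) 0 k
  rw [neg_add_cancel, zero_add] at h
  rw [star_mul', A.kernel_conjTranspose, Equiv.neg_apply, star_phase, neg_neg, h]

theorem blochMatrix_periodic (A : Hamiltonian N) (m : Fin 3 → ℤ) (ξ : Momentum) :
    blochMatrix A.op (ξ + period m) = blochMatrix A.op ξ := by
  ext i j
  simp only [blochMatrix, Matrix.of_apply]
  refine tsum_congr fun k => ?_
  congr 1
  rw [phase, phase, Complex.exp_eq_exp_iff_exists_int]
  refine ⟨∑ i, m i * k i, ?_⟩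
  simp only [period, PiLp.add_apply, add_mul, Finset.sum_add_distrib]
  push_cast
  simp only [Fin.sum_univ_three]
  ring

/-- The Bloch transform `H ∈ C^∞(𝕋³, E)` of a `ℤ³`-translation-invariant Hamiltonian. -/
noncomputable def bloch (A : Hamiltonian N) : SmoothFamily N where
  toFun := blochMatrix A.op
  isHermitian := A.blochMatrix_isHermitian
  periodic := A.blochMatrix_periodic
  smooth := A.smooth

/-- Hamiltonians carry the `C^∞` distance of their Bloch transforms. -/
noncomputable instance : PseudoMetricSpace (Hamiltonian N) :=
  PseudoMetricSpace.induced bloch inferInstance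

/-- All degeneracies of the Bloch eigenvalues are conical. -/
def HasOnlyConicalDegeneracies (A : Hamiltonian N) : Prop :=
  ∀ ξ : Momentum, A.bloch.HasDegeneracyAt ξ → A.bloch.IsConicalAt ξ

end Hamiltonian

end BlochTheory

/-! Whether a degeneracy is conical can be read off the 1-jet `(A, L)` of the family at the point.
The bad jets are those where `A` has a triple eigenvalue, or two double ones, or a double eigenvalue
with orthonormal frame `V` such that `Vᴴ * L v * V` is scalar for some `v ≠ 0`. Indeed, near a
double eigenvalue the implicit function theorem yields a smooth invariant plane, hence a smooth 2 ×
2 block `h` carrying the two eigenvalues (`exists_local_form`). They are `ℓ ± √q` with `ℓ` half the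
trace and `q` a quarter of the discriminant of `h`. With `D = Vᴴ * L v * V`, the Hessian of `q` at
`(v, v)` is `(D₀₀ - D₁₁)² / 2 + 2 |D₀₁|²`, which vanishes exactly when `D` is scalar.

Openness: the bad jets form a closed set, because frames and unit directions range over compact
sets. The jets of one family over the torus form a compact set, and the distance `d` controls jets
uniformly.

Density: a constant Hermitian matrix `r` is added to `H`; it leaves the derivative unchanged and
comes from an operator acting on each site. It suffices that the bad `r` form a null set
(`measure_badPerturbation`). With `N = k + 2`, Hermitian matrices with a double eigenvalue are
parametrized locally by the eigenvalue (1 real parameter), a plane written as a graph (`4k`) and a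
Hermitian `k × k` matrix (`k²`), so they have codimension 3. Together with `ξ` this makes `N²`
parameters, and `r` is the difference between such a matrix and `H(ξ)`. By the easy case of Sard's
theorem almost every `r` is a regular value. At a regular point, compression to the plane hides the
variation of the plane and of the complementary block. What remains is a linear map from `ℝ × ℝ³`
onto the Hermitian 2 × 2 matrices, injective by equality of dimensions, and so there is no flat
direction. A third eigenvector is incompatible with surjectivity as well. Two double eigenvalues
have codimension 6, so the corresponding `r` lie in the image of a space of dimension `N² - 3`. -/

namespace BlochTheory

open MeasureTheory Module

/-! ### Critical values of differentiable maps -/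

section CriticalValues

variable {E F : Type*} [NormedAddCommGroup E] [NormedSpace ℝ E] [FiniteDimensional ℝ E]
  [NormedAddCommGroup F] [NormedSpace ℝ F] [FiniteDimensional ℝ F]

/-- The easy case of Sard's theorem: if `dim E ≤ dim F`, then the critical values of a
differentiable map `E → F` form a null set. -/
theorem measure_criticalValues_eq_zero [MeasurableSpace F] [BorelSpace F] (μ : Measure F)
    [μ.IsAddHaarMeasure] (hEF : finrank ℝ E ≤ finrank ℝ F) {f : E → F}
    (hf : Differentiable ℝ f) :
    μ (f '' {x | ¬ Function.Surjective (fderiv ℝ f x)}) = 0 := by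
  -- Composition with a linear surjection `F → E` gives a self-map of `F` whose derivative is
  -- singular at all points over a critical point, so the equidimensional statement applies.
  obtain ⟨j, hj⟩ := (finrank_le_iff_exists_linearMap (R := ℝ) (M := E) (M' := F)).mp hEF
  obtain ⟨g, hg⟩ := LinearMap.exists_leftInverse_of_injective j (LinearMap.ker_eq_bot.mpr hj)
  have hgs : Function.Surjective g := fun x =>
    ⟨_, LinearMap.congr_fun hg x⟩
  set π : F →L[ℝ] E := g.toContinuousLinearMap
  have hπ : Function.Surjective π := hgs
  have key := addHaar_image_eq_zero_of_det_fderivWithin_eq_zero μ (f := f ∘ π)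
    (s := {y | ¬ Function.Surjective (fderiv ℝ f (π y))})
    (f' := fun y => (fderiv ℝ f (π y)).comp π)
    (fun y _ => ((hf (π y)).hasFDerivAt.comp y π.hasFDerivAt).hasFDerivWithinAt)
    (fun y hy => by
      by_contra h
      apply hy
      have h1 : Function.Surjective ((fderiv ℝ f (π y)).comp π : F →ₗ[ℝ] F) :=
        ((LinearMap.isUnit_iff_isUnit_det _).mpr (isUnit_iff_ne_zero.mpr h)
          |> (Module.End.isUnit_iff _).mp).2
      intro z
      obtain ⟨w, hw⟩ := h1 z
      exact ⟨π w, hw⟩)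
  refine measure_mono_null ?_ key
  rintro _ ⟨x, hx, rfl⟩
  obtain ⟨y, rfl⟩ := hπ x
  exact ⟨y, hx, rfl⟩

/-- If `dim E < dim F`, then the range of a differentiable map `E → F` is a null set. -/
theorem measure_range_eq_zero [MeasurableSpace F] [BorelSpace F] (μ : Measure F)
    [μ.IsAddHaarMeasure] (hEF : finrank ℝ E < finrank ℝ F) {f : E → F}
    (hf : Differentiable ℝ f) : μ (Set.range f) = 0 := by
  refine measure_mono_null ?_ (measure_criticalValues_eq_zero μ hEF.le hf)
  rintro _ ⟨x, rfl⟩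
  -- For reasons of dimension every point is critical.
  exact ⟨x, fun h => hEF.not_ge
    (LinearMap.finrank_le_finrank_of_surjective (f := (fderiv ℝ f x : E →ₗ[ℝ] F)) h), rfl⟩

end CriticalValues

/-! ### Products of functions vanishing at a point -/

section Products

variable {E : Type*} [NormedAddCommGroup E] [NormedSpace ℝ E]

/-- Such products are of second order. This is what removes the off-diagonal corrections from first
derivatives, both in the local form of the eigenvalues and in the transversality argument. -/
theorem hasFDerivAt_mul_of_eq_zero {f g : E → ℂ} {x : E} (hf : DifferentiableAt ℝ f x)
    (hg : DifferentiableAt ℝ g x) (hf0 : f x = 0) (hg0 : g x = 0) :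
    HasFDerivAt (fun y => f y * g y) (0 : E →L[ℝ] ℂ) x := by
  refine (hf.hasFDerivAt.fun_mul hg.hasFDerivAt).congr_fderiv ?_
  ext v
  change f x * fderiv ℝ g x v + g x * fderiv ℝ f x v = 0
  rw [hf0, hg0, zero_mul, zero_mul, add_zero]

/-- The second derivatives of the factors are multiplied by zero, so the Hessian of `q`, a sum of
such products, depends only on the 1-jet of the family. -/
theorem fderiv_fderiv_mul_of_eq_zero {f g : E → ℂ} {x : E} (hf : ContDiffAt ℝ 2 f x)
    (hg : ContDiffAt ℝ 2 g x) (hf0 : f x = 0) (hg0 : g x = 0) (v w : E) :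
    fderiv ℝ (fderiv ℝ fun y => f y * g y) x v w =
      fderiv ℝ f x v * fderiv ℝ g x w + fderiv ℝ g x v * fderiv ℝ f x w := by
  have e : fderiv ℝ (fun y => f y * g y) =ᶠ[nhds x]
      fun y => f y • fderiv ℝ g y + g y • fderiv ℝ f y := by
    filter_upwards [hf.eventually (by simp), hg.eventually (by simp)] with y hfy hgy
    exact fderiv_fun_mul (hfy.differentiableAt (by simp)) (hgy.differentiableAt (by simp))
  have hf' : HasFDerivAt (fderiv ℝ f) (fderiv ℝ (fderiv ℝ f) x) x :=
    ((hf.fderiv_right (m := 1) le_rfl).differentiableAt (by simp)).hasFDerivAt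
  have hg' : HasFDerivAt (fderiv ℝ g) (fderiv ℝ (fderiv ℝ g) x) x :=
    ((hg.fderiv_right (m := 1) le_rfl).differentiableAt (by simp)).hasFDerivAt
  have h := ((hf.differentiableAt (by simp)).hasFDerivAt.fun_smul hg').add
    ((hg.differentiableAt (by simp)).hasFDerivAt.fun_smul hf')
  rw [e.fderiv_eq]
  rw [show (fun y => f y • fderiv ℝ g y + g y • fderiv ℝ f y) =
    (fun y => f y • fderiv ℝ g y) + (fun y => g y • fderiv ℝ f y) from rfl, h.fderiv]
  simp [hf0, hg0]

end Products

open Matrix Polynomial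

/-! ### Ordered eigenvalues of Hermitian matrices -/

section Eigenvalues

variable {N : ℕ} {A B : Matrix (Fin N) (Fin N) ℂ}

theorem eigenvalue_monotone (hA : A.IsHermitian) : Monotone (eigenvalue hA) := fun j k h =>
  hA.eigenvalues₀_antitone (by simpa [Fin.le_def] using Fin.rev_le_rev.mpr h)

/-- The bijection between Mathlib's indexing of the eigenvalues and the increasing one. -/
noncomputable def eigenvalueEquiv (N : ℕ) : Fin N ≃ Fin N :=
  (Fintype.equivOfCardEq (Fintype.card_fin _)).symm.trans
    ((finCongr (Fintype.card_fin N)).trans Fin.revPerm)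

theorem eigenvalue_eigenvalueEquiv (hA : A.IsHermitian) (i : Fin N) :
    eigenvalue hA (eigenvalueEquiv N i) = hA.eigenvalues i := by
  simp [eigenvalue, eigenvalueEquiv, IsHermitian.eigenvalues]

theorem exists_eigenvectorBasis (hA : A.IsHermitian) :
    ∃ b : OrthonormalBasis (Fin N) ℂ (EuclideanSpace ℂ (Fin N)),
      ∀ j, A *ᵥ ⇑(b j) = (eigenvalue hA j : ℂ) • ⇑(b j) := by
  refine ⟨hA.eigenvectorBasis.reindex (eigenvalueEquiv N), fun j => ?_⟩
  obtain ⟨i, rfl⟩ := (eigenvalueEquiv N).surjective j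
  rw [OrthonormalBasis.reindex_apply, Equiv.symm_apply_apply, hA.mulVec_eigenvectorBasis,
    eigenvalue_eigenvalueEquiv]
  rfl

theorem charpoly_eq_prod_eigenvalue (hA : A.IsHermitian) :
    A.charpoly = ∏ j, (X - C (eigenvalue hA j : ℂ)) := by
  rw [hA.charpoly_eq]
  refine Eq.trans ?_ ((eigenvalueEquiv N).prod_comp _)
  simp [eigenvalue_eigenvalueEquiv]

theorem re_inner_toEuclideanCLM {b : OrthonormalBasis (Fin N) ℂ (EuclideanSpace ℂ (Fin N))}
    {μ : Fin N → ℝ} (hA : A.IsHermitian) (hb : ∀ j, A *ᵥ ⇑(b j) = (μ j : ℂ) • ⇑(b j))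
    (x : EuclideanSpace ℂ (Fin N)) :
    (inner ℂ x (toEuclideanCLM (𝕜 := ℂ) A x)).re = ∑ j, μ j * ‖inner ℂ (b j) x‖ ^ 2 := by
  have h1 : ∀ j, inner ℂ (b j) (toEuclideanCLM (𝕜 := ℂ) A x) = μ j * inner ℂ (b j) x := by
    intro j
    have hs := (isSymmetric_toEuclideanLin_iff.mpr hA) (b j) x
    have e : toEuclideanLin A (b j) = (μ j : ℂ) • b j := by
      ext i
      simpa using! congrFun (hb j) i
    rw [e, inner_smul_left] at hs
    simpa using! hs.symm
  rw [← b.sum_inner_mul_inner, Complex.re_sum]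
  refine Finset.sum_congr rfl fun j _ => ?_
  rw [h1, ← inner_conj_symm]
  rw [mul_left_comm, ← Complex.normSq_eq_conj_mul_self, Complex.normSq_eq_norm_sq]
  norm_cast

/-- Weyl's inequality. The conditions `x ⊥ a k` for `k < j` and `x ⊥ b k` for `j < k` number `N -
1`, so some `x ≠ 0` satisfies them all. Its Rayleigh quotient is at least the `j`-th eigenvalue for
`A` and at most the `j`-th eigenvalue for `B`. -/
theorem eigenvalue_le_add (hA : A.IsHermitian) (hB : B.IsHermitian) (j : Fin N) :
    eigenvalue hA j ≤ eigenvalue hB j + ‖toEuclideanCLM (𝕜 := ℂ) (A - B)‖ := by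
  obtain ⟨a, ha⟩ := exists_eigenvectorBasis hA
  obtain ⟨b, hb⟩ := exists_eigenvectorBasis hB
  obtain ⟨x, hx, hx0⟩ : ∃ x : EuclideanSpace ℂ (Fin N), x ≠ 0 ∧
      ∀ k, (k < j → inner ℂ (a k) x = 0) ∧ (j < k → inner ℂ (b k) x = 0) := by
    let φ : EuclideanSpace ℂ (Fin N) →ₗ[ℂ] ({k // k ≠ j} → ℂ) :=
      LinearMap.pi fun k => if (k : Fin N) < j then (innerₛₗ ℂ (a k)) else (innerₛₗ ℂ (b k))
    have hlt : Module.finrank ℂ ({k // k ≠ j} → ℂ) <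
        Module.finrank ℂ (EuclideanSpace ℂ (Fin N)) := by
      have := j.pos
      simp [Fintype.card_subtype_compl]
      omega
    obtain ⟨x, hx, hx0⟩ := (Submodule.ne_bot_iff _).mp
      (LinearMap.ker_ne_bot_of_finrank_lt hlt (f := φ))
    have hx' := fun k => congrFun (LinearMap.mem_ker.mp hx) k
    refine ⟨x, hx0, fun k => ⟨fun h => ?_, fun h => ?_⟩⟩
    · simpa [φ, h] using hx' ⟨k, h.ne⟩
    · simpa [φ, h.not_gt] using hx' ⟨k, h.ne'⟩
  have hxp : 0 < ‖x‖ ^ 2 := by positivity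
  have h1 : eigenvalue hA j * ‖x‖ ^ 2 ≤ (inner ℂ x (toEuclideanCLM (𝕜 := ℂ) A x)).re := by
    rw [re_inner_toEuclideanCLM hA ha, ← a.sum_sq_norm_inner_right, Finset.mul_sum]
    refine Finset.sum_le_sum fun k _ => ?_
    rcases lt_or_ge k j with h | h
    · simp [(hx0 k).1 h]
    · exact mul_le_mul_of_nonneg_right (eigenvalue_monotone hA h) (by positivity)
  have h2 : (inner ℂ x (toEuclideanCLM (𝕜 := ℂ) B x)).re ≤ eigenvalue hB j * ‖x‖ ^ 2 := by
    rw [re_inner_toEuclideanCLM hB hb, ← b.sum_sq_norm_inner_right, Finset.mul_sum]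
    refine Finset.sum_le_sum fun k _ => ?_
    rcases lt_or_ge j k with h | h
    · simp [(hx0 k).2 h]
    · exact mul_le_mul_of_nonneg_right (eigenvalue_monotone hB h) (by positivity)
  have h3 : (inner ℂ x (toEuclideanCLM (𝕜 := ℂ) (A - B) x)).re ≤
      ‖toEuclideanCLM (𝕜 := ℂ) (A - B)‖ * ‖x‖ ^ 2 := by
    refine (Complex.re_le_norm _).trans ((norm_inner_le_norm _ _).trans ?_)
    have := (toEuclideanCLM (𝕜 := ℂ) (A - B)).le_opNorm x
    nlinarith [norm_nonneg x]
  rw [map_sub, _root_.sub_apply, inner_sub_right, Complex.sub_re, ← map_sub] at h3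
  nlinarith

theorem abs_eigenvalue_sub_le (hA : A.IsHermitian) (hB : B.IsHermitian) (j : Fin N) :
    |eigenvalue hA j - eigenvalue hB j| ≤ ‖toEuclideanCLM (𝕜 := ℂ) (A - B)‖ := by
  have h1 := eigenvalue_le_add hA hB j
  have h2 := eigenvalue_le_add hB hA j
  rw [← neg_sub A B, map_neg, norm_neg] at h2
  rw [abs_le]
  constructor <;> linarith

theorem SmoothFamily.continuous_eigenvalueAt (H : SmoothFamily N) (j : Fin N) :
    Continuous (H.eigenvalueAt j) := by
  refine continuous_iff_continuousAt.mpr fun ξ => tendsto_iff_dist_tendsto_zero.mpr ?_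
  have hc : Continuous fun η => ‖toEuclideanCLM (𝕜 := ℂ) (H.toFun η - H.toFun ξ)‖ := by
    have h1 : Continuous (toEuclideanCLM (𝕜 := ℂ) (n := Fin N)) :=
      LinearMap.continuous_of_finiteDimensional
        ((toEuclideanCLM (𝕜 := ℂ) (n := Fin N)).toAlgEquiv.toLinearMap)
    exact (h1.comp (H.smooth.continuous.sub continuous_const)).norm
  have h0 := hc.tendsto ξ
  simp only [sub_self, map_zero, norm_zero] at h0
  exact squeeze_zero (fun _ => dist_nonneg)
    (fun η => abs_eigenvalue_sub_le (H.isHermitian η) (H.isHermitian ξ) j) h0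

end Eigenvalues

open Matrix Polynomial

/-! ### Orthonormal frames of eigenvectors -/

section Frames

variable {N m k : ℕ} {A : Matrix (Fin N) (Fin N) ℂ}

/-- An isometric matrix can be completed to a unitary one. -/
theorem exists_fromCols_unitary (V : Matrix (Fin N) (Fin m) ℂ) (hV : Vᴴ * V = 1) :
    ∃ (k : ℕ) (W : Matrix (Fin N) (Fin k) ℂ), m + k = N ∧
      (fromCols V W)ᴴ * fromCols V W = 1 ∧ fromCols V W * (fromCols V W)ᴴ = 1 := by
  have hinner : ∀ i j, inner ℂ (WithLp.toLp 2 (V.col i)) (WithLp.toLp 2 (V.col j)) =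
      (1 : Matrix (Fin m) (Fin m) ℂ) i j := by
    intro i j
    rw [← hV]
    simp [Matrix.mul_apply, PiLp.inner_apply, mul_comm]
  have hle : m ≤ N := by
    have ho : Orthonormal ℂ fun i => (WithLp.toLp 2 (V.col i) : EuclideanSpace ℂ (Fin N)) := by
      rw [orthonormal_iff_ite]
      intro i j
      rw [hinner, Matrix.one_apply]
    simpa using ho.linearIndependent.fintype_card_le_finrank
  obtain ⟨k, rfl⟩ := Nat.exists_eq_add_of_le hle
  let v : Fin m ⊕ Fin k → EuclideanSpace ℂ (Fin (m + k)) :=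
    Sum.elim (fun i => WithLp.toLp 2 (V.col i)) 0
  have hv : Orthonormal ℂ ((Set.range Sum.inl).domRestrict v) := by
    rw [orthonormal_iff_ite]
    rintro ⟨_, i, rfl⟩ ⟨_, j, rfl⟩
    change inner ℂ (WithLp.toLp 2 (V.col i)) (WithLp.toLp 2 (V.col j)) = _
    rw [hinner, Matrix.one_apply]
    simp [Subtype.ext_iff]
  obtain ⟨b, hb⟩ := hv.exists_orthonormalBasis_extension_of_card_eq (by simp)
  have hU : fromCols V (Matrix.of fun i j => b (Sum.inr j) i) = Matrix.of fun i j => b j i := by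
    ext i (j | j)
    · simp [hb (Sum.inl j) ⟨j, rfl⟩, v]
    · simp
  have h1 : (Matrix.of fun i j => b j i)ᴴ * (Matrix.of fun i j => b j i) =
      (1 : Matrix (Fin m ⊕ Fin k) (Fin m ⊕ Fin k) ℂ) := by
    ext i j
    have := orthonormal_iff_ite.mp b.orthonormal i j
    rw [Matrix.one_apply, ← this]
    simp [Matrix.mul_apply, PiLp.inner_apply, mul_comm]
  refine ⟨k, Matrix.of fun i j => b (Sum.inr j) i, rfl, ?_⟩
  rw [hU]
  exact ⟨h1, (mul_eq_one_comm_of_card_eq _ _ _ (by simp)).mp h1⟩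

theorem charpoly_unitary_conj {ι : Type*} [Fintype ι] [DecidableEq ι]
    {U : Matrix (Fin N) ι ℂ} (h1 : Uᴴ * U = 1) (h2 : U * Uᴴ = 1) :
    (Uᴴ * A * U).charpoly = A.charpoly := by
  -- The two traces of `1` count the two index sets, and cyclicity of the trace identifies them.
  have hc : Fintype.card ι = Fintype.card (Fin N) := by
    have e1 := congrArg trace h1
    have e2 := congrArg trace h2
    rw [trace_mul_comm, e2] at e1
    simp only [trace_one] at e1
    exact_mod_cast e1.symm
  have h := Matrix.charpoly_mul_comm' (Uᴴ * A) U
  rw [hc, ← Matrix.mul_assoc, h2, Matrix.one_mul] at h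
  exact mul_left_cancel₀ (pow_ne_zero _ X_ne_zero) h

/-- A Hermitian matrix is block diagonal in a unitary basis adapted to an eigenspace. -/
theorem conj_fromCols_eq_fromBlocks {V : Matrix (Fin N) (Fin m) ℂ} {W : Matrix (Fin N) (Fin k) ℂ}
    (hA : A.IsHermitian) {l : ℝ} (hVA : A * V = (l : ℂ) • V)
    (hU : (fromCols V W)ᴴ * fromCols V W = 1) :
    (fromCols V W)ᴴ * A * fromCols V W =
      fromBlocks ((l : ℂ) • 1) 0 0 (Wᴴ * A * W) := by
  rw [conjTranspose_fromCols_eq_fromRows_conjTranspose, fromRows_mul_fromCols,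
    ← fromBlocks_one, fromBlocks_inj] at hU
  obtain ⟨h11, h12, h21, h22⟩ := hU
  have hVA' : Vᴴ * A = (l : ℂ) • Vᴴ := by
    have := congrArg conjTranspose hVA
    simpa [hA.eq] using this
  rw [conjTranspose_fromCols_eq_fromRows_conjTranspose, fromRows_mul, fromRows_mul_fromCols,
    fromBlocks_inj]
  refine ⟨?_, ?_, ?_, rfl⟩
  · rw [hVA', Matrix.smul_mul, h11]
  · rw [hVA', Matrix.smul_mul, h12, smul_zero]
  · rw [Matrix.mul_assoc, hVA, Matrix.mul_smul, h21, smul_zero]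

/-- The eigenvalue belonging to an isometric matrix of eigenvectors is real. -/
theorem exists_real_of_mul_eq_smul (hA : A.IsHermitian) {V : Matrix (Fin N) (Fin m) ℂ}
    (hV : Vᴴ * V = 1) {c : ℂ} (hVA : A * V = c • V) (hm : 0 < m) : ∃ l : ℝ, c = l := by
  have h1 : Vᴴ * A * V = c • 1 := by rw [Matrix.mul_assoc, hVA, Matrix.mul_smul, hV]
  have h2 : (c • (1 : Matrix (Fin m) (Fin m) ℂ)).IsHermitian := by
    rw [← h1]
    exact isHermitian_conjTranspose_mul_mul V hA
  have h3 := h2.apply ⟨0, hm⟩ ⟨0, hm⟩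
  simp only [Matrix.smul_apply, one_apply_eq, smul_eq_mul, mul_one] at h3
  exact ⟨c.re, (Complex.conj_eq_iff_re.mp h3).symm⟩

theorem rootMultiplicity_charpoly (hA : A.IsHermitian) (l : ℝ) :
    rootMultiplicity (l : ℂ) A.charpoly =
      (Finset.univ.filter fun j => eigenvalue hA j = l).card := by
  have e : A.charpoly = (((Finset.univ.val.map fun j =>
      (eigenvalue hA j : ℂ))).map fun a => X - C a).prod := by
    rw [charpoly_eq_prod_eigenvalue hA, Multiset.map_map]
    rfl
  rw [← count_roots, e, roots_multiset_prod_X_sub_C, Multiset.count_map, Finset.card_def,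
    Finset.filter_val]
  congr 1
  refine Multiset.filter_congr fun j _ => ?_
  rw [eq_comm]
  norm_cast

theorem charpoly_eq_pow_mul {V : Matrix (Fin N) (Fin m) ℂ} {W : Matrix (Fin N) (Fin k) ℂ}
    (hA : A.IsHermitian) {l : ℝ} (hVA : A * V = (l : ℂ) • V)
    (h1 : (fromCols V W)ᴴ * fromCols V W = 1) (h2 : fromCols V W * (fromCols V W)ᴴ = 1) :
    A.charpoly = (X - C (l : ℂ)) ^ m * (Wᴴ * A * W).charpoly := by
  rw [← charpoly_unitary_conj h1 h2, conj_fromCols_eq_fromBlocks hA hVA h1,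
    charpoly_fromBlocks_zero₂₁, smul_one_eq_diagonal, charpoly_diagonal]
  simp

/-- An orthonormal family of `m` eigenvectors forces an `m`-fold eigenvalue. -/
theorem le_card_eigenvalue_eq (hA : A.IsHermitian) {V : Matrix (Fin N) (Fin m) ℂ}
    (hV : Vᴴ * V = 1) {l : ℝ} (hVA : A * V = (l : ℂ) • V) :
    m ≤ (Finset.univ.filter fun j => eigenvalue hA j = l).card := by
  obtain ⟨k, W, -, h1, h2⟩ := exists_fromCols_unitary V hV
  rw [← rootMultiplicity_charpoly, le_rootMultiplicity_iff (charpoly_monic A).ne_zero,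
    charpoly_eq_pow_mul hA hVA h1 h2]
  exact dvd_mul_right _ _

/-- An `m`-fold eigenvalue has an orthonormal family of `m` eigenvectors. -/
theorem exists_frame_of_injective {ι : Type*} [Fintype ι] [DecidableEq ι] (hA : A.IsHermitian)
    (f : ι → Fin N) (hf : Function.Injective f) :
    ∃ V : Matrix (Fin N) ι ℂ, Vᴴ * V = 1 ∧
      A * V = V * diagonal fun i => (eigenvalue hA (f i) : ℂ) := by
  obtain ⟨b, hb⟩ := exists_eigenvectorBasis hA
  refine ⟨Matrix.of fun i j => b (f j) i, ?_, ?_⟩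
  · ext i j
    have := orthonormal_iff_ite.mp b.orthonormal (f i) (f j)
    simp only [hf.eq_iff] at this
    rw [Matrix.one_apply, ← this]
    simp [Matrix.mul_apply, PiLp.inner_apply, mul_comm]
  · ext i j
    have := congrFun (hb (f j)) i
    rw [mul_diagonal, mul_comm]
    exact this

end Frames

open Matrix Polynomial Filter Topology

/-- The topology of the Frobenius norm, preferred to the (equal) product topology so that spaces of
continuous linear maps into matrices are normed. -/
noncomputable local instance (priority := 2000) frobeniusTopology {m n : Type*} [Fintype m]
    [Fintype n] : TopologicalSpace (Matrix m n ℂ) :=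
  Matrix.frobeniusNormedAddCommGroup.toPseudoMetricSpace.toUniformSpace.toTopologicalSpace

/-! ### Calculus of matrix-valued maps -/

section MatrixCalculus

variable {𝕜 : Type*} [RCLike 𝕜] [NormedAlgebra 𝕜 ℂ] [FiniteDimensional 𝕜 ℂ]
  {E : Type*} [NormedAddCommGroup E] [NormedSpace 𝕜 E]
  {m n l : Type*} [Fintype m] [Fintype n] [Fintype l]

/-- Matrices with the Frobenius norm are linearly homeomorphic to functions of two indices. -/
noncomputable def matrixEquivPi (𝕜 : Type*) [RCLike 𝕜] [NormedAlgebra 𝕜 ℂ]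
    [FiniteDimensional 𝕜 ℂ] (m n : Type*) [Fintype m] [Fintype n] :
    Matrix m n ℂ ≃L[𝕜] (m → n → ℂ) :=
  (Matrix.ofLinearEquiv 𝕜).symm.toContinuousLinearEquiv

/-- The entry of a matrix at a given position, as a continuous linear map. -/
noncomputable def entryCLM (𝕜 : Type*) [RCLike 𝕜] [NormedAlgebra 𝕜 ℂ]
    [FiniteDimensional 𝕜 ℂ] {m n : Type*} [Fintype m] [Fintype n] (i : m) (j : n) :
    Matrix m n ℂ →L[𝕜] ℂ :=
  (Matrix.entryLinearMap 𝕜 ℂ i j).toContinuousLinearMap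

theorem contDiffAt_matrix {F : E → Matrix m n ℂ} {x : E} {r : WithTop ℕ∞} :
    ContDiffAt 𝕜 r F x ↔ ∀ i j, ContDiffAt 𝕜 r (fun y => F y i j) x := by
  rw [← (matrixEquivPi 𝕜 m n).comp_contDiffAt_iff, contDiffAt_pi]
  exact forall_congr' fun i => contDiffAt_pi

theorem differentiable_matrix {F : E → Matrix m n ℂ} :
    Differentiable 𝕜 F ↔ ∀ i j, Differentiable 𝕜 (fun y => F y i j) := by
  refine (matrixEquivPi 𝕜 m n).comp_differentiable_iff.symm.trans (differentiable_pi.trans ?_)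
  exact forall_congr' fun i => differentiable_pi

theorem contDiffAt_matrix_entry {F : E → Matrix m n ℂ} {x : E} {r : WithTop ℕ∞}
    (hF : ContDiffAt 𝕜 r F x) (i : m) (j : n) : ContDiffAt 𝕜 r (fun y => F y i j) x :=
  contDiffAt_matrix.mp hF i j

theorem contDiffAt_matrix_mul {F : E → Matrix m n ℂ} {G : E → Matrix n l ℂ} {x : E}
    {r : WithTop ℕ∞} (hF : ContDiffAt 𝕜 r F x) (hG : ContDiffAt 𝕜 r G x) :
    ContDiffAt 𝕜 r (fun y => F y * G y) x := by
  refine contDiffAt_matrix.mpr fun i j => ?_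
  simp only [Matrix.mul_apply]
  exact ContDiffAt.sum fun k _ =>
    (contDiffAt_matrix_entry hF i k).mul (contDiffAt_matrix_entry hG k j)

theorem hasFDerivAt_matrix_entry {F : E → Matrix m n ℂ} {F' : E →L[𝕜] Matrix m n ℂ} {x : E}
    (hF : HasFDerivAt F F' x) (i : m) (j : n) :
    HasFDerivAt (fun y => F y i j) ((entryCLM 𝕜 i j).comp F') x :=
  (entryCLM 𝕜 i j).hasFDerivAt.comp x hF

end MatrixCalculus

/-! ### Smooth invariant subspaces -/

section Riccati

variable {κ : Type*} [Fintype κ]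

/-- The range of `[1; X]` is invariant under `M` if and only if this vanishes. -/
def riccati (p : Matrix (Fin 2 ⊕ κ) (Fin 2 ⊕ κ) ℂ × Matrix κ (Fin 2) ℂ) : Matrix κ (Fin 2) ℂ :=
  p.1.toBlocks₂₁ + p.1.toBlocks₂₂ * p.2 - p.2 * (p.1.toBlocks₁₁ + p.1.toBlocks₁₂ * p.2)

theorem contDiffAt_riccati (p : Matrix (Fin 2 ⊕ κ) (Fin 2 ⊕ κ) ℂ × Matrix κ (Fin 2) ℂ) :
    ContDiffAt ℂ ω (riccati (κ := κ)) p := by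
  have h : ∀ i j, ContDiffAt ℂ ω (fun p : Matrix (Fin 2 ⊕ κ) (Fin 2 ⊕ κ) ℂ × Matrix κ (Fin 2) ℂ =>
      p.1 i j) p := contDiffAt_matrix.mp contDiffAt_fst
  have h2 : ContDiffAt ℂ ω (fun p : Matrix (Fin 2 ⊕ κ) (Fin 2 ⊕ κ) ℂ × Matrix κ (Fin 2) ℂ =>
      p.2) p := contDiffAt_snd
  have h11 : ContDiffAt ℂ ω (fun p : Matrix (Fin 2 ⊕ κ) (Fin 2 ⊕ κ) ℂ × Matrix κ (Fin 2) ℂ =>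
      p.1.toBlocks₁₁) p := contDiffAt_matrix.mpr fun i j => h _ _
  have h12 : ContDiffAt ℂ ω (fun p : Matrix (Fin 2 ⊕ κ) (Fin 2 ⊕ κ) ℂ × Matrix κ (Fin 2) ℂ =>
      p.1.toBlocks₁₂) p := contDiffAt_matrix.mpr fun i j => h _ _
  have h21 : ContDiffAt ℂ ω (fun p : Matrix (Fin 2 ⊕ κ) (Fin 2 ⊕ κ) ℂ × Matrix κ (Fin 2) ℂ =>
      p.1.toBlocks₂₁) p := contDiffAt_matrix.mpr fun i j => h _ _
  have h22 : ContDiffAt ℂ ω (fun p : Matrix (Fin 2 ⊕ κ) (Fin 2 ⊕ κ) ℂ × Matrix κ (Fin 2) ℂ =>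
      p.1.toBlocks₂₂) p := contDiffAt_matrix.mpr fun i j => h _ _
  exact (h21.add (contDiffAt_matrix_mul h22 h2)).sub
    (contDiffAt_matrix_mul h2 (h11.add (contDiffAt_matrix_mul h12 h2)))

/-- An isolated semisimple eigenvalue of multiplicity two has an invariant subspace depending
smoothly on the matrix. -/
theorem exists_smooth_invariant_graph [DecidableEq κ] (l : ℂ)
    (D : Matrix κ κ ℂ) (hD : IsUnit (D - l • 1)) :
    ∃ Y : Matrix (Fin 2 ⊕ κ) (Fin 2 ⊕ κ) ℂ → Matrix κ (Fin 2) ℂ,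
      Y (fromBlocks (l • 1) 0 0 D) = 0 ∧
      ∀ᶠ M in 𝓝 (fromBlocks (l • 1) 0 0 D), ContDiffAt ℝ ∞ Y M ∧ riccati (M, Y M) = 0 := by
  set M₀ : Matrix (Fin 2 ⊕ κ) (Fin 2 ⊕ κ) ℂ := fromBlocks (l • 1) 0 0 D with hM₀
  have : CompleteSpace (Matrix (Fin 2 ⊕ κ) (Fin 2 ⊕ κ) ℂ) := FiniteDimensional.complete ℂ _
  have : CompleteSpace (Matrix κ (Fin 2) ℂ) := FiniteDimensional.complete ℂ _
  -- At the block-diagonal base point the Riccati map is linear in `Y`, and the hypothesis on `D`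
  -- makes it bijective. This is the invertibility needed by the implicit function theorem, applied
  -- over `ℂ` and then restricted to real scalars.
  have hlin : ∀ Y : Matrix κ (Fin 2) ℂ, riccati (M₀, Y) = (D - l • 1) * Y := by
    intro Y
    simp [riccati, hM₀, Matrix.sub_mul]
  have h0 : riccati (M₀, (0 : Matrix κ (Fin 2) ℂ)) = 0 := by rw [hlin, Matrix.mul_zero]
  have hdet : IsUnit (D - l • 1).det := (isUnit_iff_isUnit_det _).mp hD
  let e : Matrix κ (Fin 2) ℂ ≃ₗ[ℂ] Matrix κ (Fin 2) ℂ :=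
    { toFun := fun Y => (D - l • 1) * Y
      map_add' := fun _ _ => Matrix.mul_add _ _ _
      map_smul' := fun _ _ => Matrix.mul_smul _ _ _
      invFun := fun Y => (D - l • 1)⁻¹ * Y
      left_inv := fun Y => by simp [← Matrix.mul_assoc, nonsing_inv_mul _ hdet]
      right_inv := fun Y => by simp [← Matrix.mul_assoc, mul_nonsing_inv _ hdet] }
  have cd := contDiffAt_riccati (M₀, (0 : Matrix κ (Fin 2) ℂ))
  have hinv : (fderiv ℂ (riccati (κ := κ)) (M₀, 0) ∘L .inr ℂ _ _).IsInvertible := by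
    refine ⟨e.toContinuousLinearEquiv, ?_⟩
    have h1 : HasFDerivAt (fun Y : Matrix κ (Fin 2) ℂ => riccati (M₀, Y))
        (fderiv ℂ (riccati (κ := κ)) (M₀, 0) ∘L .inr ℂ _ _) 0 :=
      HasFDerivAt.comp (g := riccati) (0 : Matrix κ (Fin 2) ℂ)
        (cd.differentiableAt (by simp)).hasFDerivAt (hasFDerivAt_prodMk_right M₀ 0)
    refine HasFDerivAt.unique ?_ h1
    simp only [hlin]
    exact (e.toContinuousLinearEquiv : Matrix κ (Fin 2) ℂ →L[ℂ] Matrix κ (Fin 2) ℂ).hasFDerivAt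
  refine ⟨cd.implicitFunction (by simp) hinv, cd.implicitFunction_apply_self _ hinv, ?_⟩
  filter_upwards [(cd.contDiffAt_implicitFunction (by simp) hinv).eventually (by simp),
    cd.eventually_apply_implicitFunction (by simp) hinv] with M h1 h2
  exact ⟨(h1.restrict_scalars ℝ).of_le le_top, h2.trans h0⟩

/-- Conjugation by the unipotent matrix with lower-left block `Y` makes `M` block upper triangular.
The diagonal blocks describe `M` on the invariant graph and on the quotient. -/
theorem charpoly_eq_of_riccati [DecidableEq κ] {M : Matrix (Fin 2 ⊕ κ) (Fin 2 ⊕ κ) ℂ}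
    {Y : Matrix κ (Fin 2) ℂ}
    (h : riccati (M, Y) = 0) :
    M.charpoly = (M.toBlocks₁₁ + M.toBlocks₁₂ * Y).charpoly *
      (M.toBlocks₂₂ - Y * M.toBlocks₁₂).charpoly := by
  have h' : M.toBlocks₂₁ + M.toBlocks₂₂ * Y = Y * (M.toBlocks₁₁ + M.toBlocks₁₂ * Y) :=
    sub_eq_zero.mp h
  have e1 : fromBlocks 1 0 (-Y) 1 * fromBlocks 1 0 Y 1 =
      (1 : Matrix (Fin 2 ⊕ κ) (Fin 2 ⊕ κ) ℂ) := by
    simp [fromBlocks_multiply]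
  have e2 : fromBlocks 1 0 (-Y) 1 * M * fromBlocks 1 0 Y 1 =
      fromBlocks (M.toBlocks₁₁ + M.toBlocks₁₂ * Y) M.toBlocks₁₂ 0
        (M.toBlocks₂₂ - Y * M.toBlocks₁₂) := by
    nth_rw 1 [← fromBlocks_toBlocks M]
    rw [fromBlocks_multiply, fromBlocks_multiply]
    simp only [Matrix.one_mul, Matrix.zero_mul, add_zero, Matrix.mul_one, Matrix.mul_zero,
      zero_add, Matrix.neg_mul, fromBlocks_inj, true_and]
    constructor
    · rw [Matrix.add_mul, Matrix.neg_mul, add_add_add_comm, h', Matrix.mul_add]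
      simp only [Matrix.mul_assoc]
      abel
    · abel
  rw [← charpoly_fromBlocks_zero₂₁, ← e2, charpoly_mul_comm, ← Matrix.mul_assoc]
  rw [mul_eq_one_comm.mp e1, Matrix.one_mul]

end Riccati

open Matrix Polynomial Filter Topology

/-! ### Second derivatives of real parts and of sums -/

section SecondDerivatives

variable {E : Type*} [NormedAddCommGroup E] [NormedSpace ℝ E]

theorem fderiv_fderiv_re {f : E → ℂ} {x : E} (hf : ContDiffAt ℝ 2 f x) (v w : E) :
    fderiv ℝ (fderiv ℝ fun y => (f y).re) x v w = (fderiv ℝ (fderiv ℝ f) x v w).re := by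
  have e : fderiv ℝ (fun y => (f y).re) =ᶠ[𝓝 x]
      fun y => ContinuousLinearMap.compL ℝ E ℂ ℝ Complex.reCLM (fderiv ℝ f y) := by
    filter_upwards [hf.eventually (by simp)] with y hy
    exact (Complex.reCLM.hasFDerivAt.comp y
      (hy.differentiableAt (by simp)).hasFDerivAt).fderiv
  have hf' : HasFDerivAt (fderiv ℝ f) (fderiv ℝ (fderiv ℝ f) x) x :=
    ((hf.fderiv_right (m := 1) le_rfl).differentiableAt (by simp)).hasFDerivAt
  have h : HasFDerivAt (fun y => ContinuousLinearMap.compL ℝ E ℂ ℝ Complex.reCLM (fderiv ℝ f y))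
      ((ContinuousLinearMap.compL ℝ E ℂ ℝ Complex.reCLM).comp (fderiv ℝ (fderiv ℝ f) x)) x :=
    (ContinuousLinearMap.compL ℝ E ℂ ℝ Complex.reCLM).hasFDerivAt.comp x hf'
  rw [e.fderiv_eq, h.fderiv]
  rfl

theorem fderiv_fderiv_add {f g : E → ℂ} {x : E} (hf : ContDiffAt ℝ 2 f x)
    (hg : ContDiffAt ℝ 2 g x) (v w : E) :
    fderiv ℝ (fderiv ℝ fun y => f y + g y) x v w =
      fderiv ℝ (fderiv ℝ f) x v w + fderiv ℝ (fderiv ℝ g) x v w := by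
  have e : fderiv ℝ (fun y => f y + g y) =ᶠ[𝓝 x] fun y => fderiv ℝ f y + fderiv ℝ g y := by
    filter_upwards [hf.eventually (by simp), hg.eventually (by simp)] with y hfy hgy
    exact fderiv_fun_add (hfy.differentiableAt (by simp)) (hgy.differentiableAt (by simp))
  have hf' := (hf.fderiv_right (m := 1) le_rfl).differentiableAt (by simp)
  have hg' := (hg.fderiv_right (m := 1) le_rfl).differentiableAt (by simp)
  rw [e.fderiv_eq, fderiv_fun_add hf' hg']
  rfl

end SecondDerivatives

/-! ### Local form of the eigenvalues near a double eigenvalue -/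

section LocalForm

variable {N : ℕ}

/-- If a product of two monic polynomials, the first one of degree two, has the roots `a` and `b`,
which are not roots of the second factor, then they are the roots of the first one. -/
theorem charpoly_fin_two_eq_of_dvd {h : Matrix (Fin 2) (Fin 2) ℂ} {p : ℂ[X]} {a b : ℂ}
    (hdvd : (X - C a) * (X - C b) ∣ h.charpoly * p) (ha : p.eval a ≠ 0) (hb : p.eval b ≠ 0) :
    h.trace = a + b ∧ h.det = a * b := by
  have hco : ∀ c : ℂ, p.eval c ≠ 0 → IsCoprime (X - C c) p := fun c hc =>
    (irreducible_X_sub_C c).coprime_iff_not_dvd.mpr fun hd => hc (dvd_iff_isRoot.mp hd)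
  have hd : (X - C a) * (X - C b) ∣ h.charpoly :=
    ((hco a ha).mul_left (hco b hb)).dvd_of_dvd_mul_right hdvd
  have he : h.charpoly = (X - C a) * (X - C b) := by
    refine (eq_of_monic_of_dvd_of_natDegree_le ((monic_X_sub_C a).mul (monic_X_sub_C b))
      h.charpoly_monic hd ?_)
    rw [(monic_X_sub_C a).natDegree_mul (monic_X_sub_C b), charpoly_natDegree_eq_dim]
    simp
  rw [charpoly_fin_two] at he
  -- The value at 0 gives the determinant, and the value at 1 then gives the trace.
  have e0 := congrArg (eval 0) he
  have e1 := congrArg (eval 1) he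
  simp at e0 e1
  refine ⟨?_, e0⟩
  linear_combination e0 - e1

/-- In a unitary basis adapted to the eigenplane, the family is block diagonal at `ξ₀`, and nearby
it has a smooth invariant graph on which it acts by a 2 × 2 matrix `h`. The complementary factor of
the characteristic polynomial does not vanish at the two eigenvalues, so these are the roots of the
characteristic polynomial of `h`. The frame `V` is arbitrary, which lets the Hessian be computed in
whichever frame exhibits a flat direction. -/
theorem exists_local_form (H : SmoothFamily N) (ξ₀ : Momentum) {n n' : Fin N} (hne : n ≠ n')
    (hle : ∀ ξ, H.eigenvalueAt n ξ ≤ H.eigenvalueAt n' ξ) {l : ℝ}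
    (hn : H.eigenvalueAt n ξ₀ = l) (hn' : H.eigenvalueAt n' ξ₀ = l)
    (hsimple : ∀ j, j ≠ n → j ≠ n' → H.eigenvalueAt j ξ₀ ≠ l)
    {V : Matrix (Fin N) (Fin 2) ℂ} (hV : Vᴴ * V = 1)
    (hVA : H.toFun ξ₀ * V = (l : ℂ) • V) :
    ∃ (Ω : Set Momentum) (ℓ q : Momentum → ℝ),
      IsOpen Ω ∧ ξ₀ ∈ Ω ∧ ContDiffOn ℝ ∞ ℓ Ω ∧ ContDiffOn ℝ ∞ q Ω ∧ (∀ ξ ∈ Ω, 0 ≤ q ξ) ∧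
      q ξ₀ = 0 ∧ fderiv ℝ q ξ₀ = 0 ∧
      (∀ v w, fderiv ℝ (fderiv ℝ q) ξ₀ v w =
        (((Vᴴ * fderiv ℝ H.toFun ξ₀ v * V) 0 0 - (Vᴴ * fderiv ℝ H.toFun ξ₀ v * V) 1 1) *
        ((Vᴴ * fderiv ℝ H.toFun ξ₀ w * V) 0 0 - (Vᴴ * fderiv ℝ H.toFun ξ₀ w * V) 1 1) / 2 +
        (Vᴴ * fderiv ℝ H.toFun ξ₀ v * V) 0 1 * (Vᴴ * fderiv ℝ H.toFun ξ₀ w * V) 1 0 +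
        (Vᴴ * fderiv ℝ H.toFun ξ₀ v * V) 1 0 * (Vᴴ * fderiv ℝ H.toFun ξ₀ w * V) 0 1).re) ∧
      ∀ ξ ∈ Ω, H.eigenvalueAt n ξ = ℓ ξ - √(q ξ) ∧ H.eigenvalueAt n' ξ = ℓ ξ + √(q ξ) := by
  obtain ⟨k, W, -, hU1, hU2⟩ := exists_fromCols_unitary V hV
  have hH₀ : (H.toFun ξ₀).IsHermitian := H.isHermitian ξ₀
  set U := fromCols V W with hU
  set D : Matrix (Fin k) (Fin k) ℂ := Wᴴ * H.toFun ξ₀ * W with hD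
  set M : Momentum → Matrix (Fin 2 ⊕ Fin k) (Fin 2 ⊕ Fin k) ℂ := fun ξ => Uᴴ * H.toFun ξ * U
    with hM
  have hM₀ : M ξ₀ = fromBlocks ((l : ℂ) • 1) 0 0 D := conj_fromCols_eq_fromBlocks hH₀ hVA hU1
  -- A root of the complementary block at `l` would make `l` a triple eigenvalue, whereas only the
  -- indices `n` and `n'` carry it.
  have hDl : D.charpoly.eval (l : ℂ) ≠ 0 := by
    intro h0
    have h1 := rootMultiplicity_charpoly hH₀ l
    have h2 : (Finset.univ.filter fun j => eigenvalue hH₀ j = l).card ≤ 2 := by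
      refine (Finset.card_le_card (t := {n, n'}) fun j hj => ?_).trans (Finset.card_le_two)
      by_contra hj'
      simp only [Finset.mem_insert, Finset.mem_singleton, not_or] at hj'
      exact hsimple j hj'.1 hj'.2 (Finset.mem_filter.mp hj).2
    have h3 : (X - C (l : ℂ)) ^ 3 ∣ (H.toFun ξ₀).charpoly := by
      rw [charpoly_eq_pow_mul hH₀ hVA hU1 hU2, pow_succ]
      exact mul_dvd_mul_left _ (dvd_iff_isRoot.mpr h0)
    have h4 := (le_rootMultiplicity_iff (charpoly_monic _).ne_zero).mpr h3
    omega
  have hDu : IsUnit (D - (l : ℂ) • 1) := by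
    rw [isUnit_iff_isUnit_det, ← neg_sub, det_neg, isUnit_iff_ne_zero]
    refine mul_ne_zero (pow_ne_zero _ (by norm_num)) ?_
    rw [eval_charpoly] at hDl
    rwa [smul_one_eq_diagonal]
  obtain ⟨Y, hY₀, hY⟩ := exists_smooth_invariant_graph (l : ℂ) D hDu
  rw [← hM₀] at hY₀ hY
  have hMs : ∀ ξ, ContDiffAt ℝ ∞ M ξ := fun ξ =>
    contDiffAt_matrix_mul (contDiffAt_matrix_mul contDiffAt_const H.smooth.contDiffAt)
      contDiffAt_const
  have hYM : ∀ᶠ ξ in 𝓝 ξ₀, ContDiffAt ℝ ∞ (fun ξ => Y (M ξ)) ξ ∧ riccati (M ξ, Y (M ξ)) = 0 := by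
    filter_upwards [(hMs ξ₀).continuousAt.eventually hY] with ξ hξ
    exact ⟨hξ.1.comp ξ (hMs ξ), hξ.2⟩
  set Z := fun ξ => Y (M ξ) with hZ
  set h : Momentum → Matrix (Fin 2) (Fin 2) ℂ :=
    fun ξ => (M ξ).toBlocks₁₁ + (M ξ).toBlocks₁₂ * Z ξ with hh
  set R : Momentum → Matrix (Fin k) (Fin k) ℂ :=
    fun ξ => (M ξ).toBlocks₂₂ - Z ξ * (M ξ).toBlocks₁₂ with hR
  have hMb : ∀ ξ i j, ContDiffAt ℝ ∞ (fun ξ => M ξ i j) ξ := fun ξ i j =>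
    contDiffAt_matrix_entry (hMs ξ) i j
  have hhs : ∀ ξ, ContDiffAt ℝ ∞ Z ξ → ContDiffAt ℝ ∞ h ξ := fun ξ hξ =>
    ContDiffAt.add (contDiffAt_matrix.mpr fun i j => hMb ξ _ _)
      (contDiffAt_matrix_mul (contDiffAt_matrix.mpr fun i j => hMb ξ _ _) hξ)
  have hRs : ContinuousAt R ξ₀ :=
    (ContDiffAt.sub (contDiffAt_matrix.mpr fun i j => hMb ξ₀ _ _)
      (contDiffAt_matrix_mul (l := Fin k) hYM.self_of_nhds.1
        (contDiffAt_matrix.mpr fun i j => hMb ξ₀ _ _))).continuousAt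
  -- At `ξ₀` the block `R` equals `D`. Continuity of the eigenvalues and of `R` propagates the
  -- non-vanishing.
  have hroot : ∀ j, H.eigenvalueAt j ξ₀ = l →
      ∀ᶠ ξ in 𝓝 ξ₀, (R ξ).charpoly.eval (H.eigenvalueAt j ξ : ℂ) ≠ 0 := by
    intro j hj
    have hc : ContinuousAt (fun ξ => ((H.eigenvalueAt j ξ : ℂ) •
        (1 : Matrix (Fin k) (Fin k) ℂ) - R ξ).det) ξ₀ := by
      have h1 : Continuous fun A : Matrix (Fin k) (Fin k) ℂ => A.det := continuous_id.matrix_det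
      refine h1.continuousAt.comp (ContinuousAt.sub ?_ hRs)
      exact ((Complex.continuous_ofReal.comp (H.continuous_eigenvalueAt j)).smul
        continuous_const).continuousAt
    have e : ∀ ξ, (R ξ).charpoly.eval (H.eigenvalueAt j ξ : ℂ) = ((H.eigenvalueAt j ξ : ℂ) •
        (1 : Matrix (Fin k) (Fin k) ℂ) - R ξ).det := fun ξ => by
      rw [eval_charpoly, smul_one_eq_diagonal]
      rfl
    simp only [e]
    refine hc.eventually_ne ?_
    rw [← e, hj]
    simpa [hR, hZ, hY₀, hM₀] using hDl
  obtain ⟨Ω, hΩ, hΩo, hΩ₀⟩ := mem_nhds_iff.mp (hYM.and ((hroot n hn).and (hroot n' hn')))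
  have htd : ∀ ξ ∈ Ω, (h ξ).trace = H.eigenvalueAt n ξ + H.eigenvalueAt n' ξ ∧
      (h ξ).det = H.eigenvalueAt n ξ * H.eigenvalueAt n' ξ := by
    intro ξ hξ
    obtain ⟨⟨-, h1⟩, h2, h3⟩ := hΩ hξ
    refine charpoly_fin_two_eq_of_dvd (p := (R ξ).charpoly) ?_ h2 h3
    rw [← charpoly_eq_of_riccati h1, charpoly_unitary_conj hU1 hU2,
      charpoly_eq_prod_eigenvalue (H.isHermitian ξ), ← Finset.prod_pair
        (f := fun j => X - C (H.eigenvalueAt j ξ : ℂ)) hne]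
    exact Finset.prod_dvd_prod_of_subset _ _ _ (Finset.subset_univ _)
  -- A quarter of the discriminant of `h`. The matrix `h` need not be Hermitian, but its trace and
  -- determinant are the sum and product of two real eigenvalues.
  have hq : ∀ ξ ∈ Ω, (((h ξ 0 0 - h ξ 1 1) / 2) * ((h ξ 0 0 - h ξ 1 1) / 2) +
      h ξ 0 1 * h ξ 1 0).re = ((H.eigenvalueAt n' ξ - H.eigenvalueAt n ξ) / 2) ^ 2 := by
    intro ξ hξ
    obtain ⟨h1, h2⟩ := htd ξ hξ
    rw [trace_fin_two] at h1
    rw [det_fin_two] at h2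
    have : ((h ξ 0 0 - h ξ 1 1) / 2) * ((h ξ 0 0 - h ξ 1 1) / 2) + h ξ 0 1 * h ξ 1 0 =
        (((H.eigenvalueAt n' ξ - H.eigenvalueAt n ξ) / 2) ^ 2 : ℝ) := by
      push_cast
      linear_combination (h ξ 0 0 + h ξ 1 1 + H.eigenvalueAt n ξ + H.eigenvalueAt n' ξ) / 4 * h1
        - h2
    rw [this, Complex.ofReal_re]
  have hent : ∀ ξ ∈ Ω, ∀ i j, ContDiffAt ℝ ∞ (fun ξ => h ξ i j) ξ := fun ξ hξ i j =>
    contDiffAt_matrix_entry (hhs ξ (hΩ hξ).1.1) i j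
  have hQs : ∀ ξ ∈ Ω, ContDiffAt ℝ ∞ (fun ξ => ((h ξ 0 0 - h ξ 1 1) / 2) *
      ((h ξ 0 0 - h ξ 1 1) / 2) + h ξ 0 1 * h ξ 1 0) ξ := fun ξ hξ => by
    have hu := ((hent ξ hξ 0 0).sub (hent ξ hξ 1 1)).div_const 2
    exact (hu.mul hu).add ((hent ξ hξ 0 1).mul (hent ξ hξ 1 0))
  have hh₀ : h ξ₀ = (l : ℂ) • 1 := by simp [hh, hZ, hM₀]
  have hder : ∀ i j v, fderiv ℝ (fun ξ => h ξ i j) ξ₀ v = (Vᴴ * fderiv ℝ H.toFun ξ₀ v * V) i j := by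
    intro i j v
    let Λ : Matrix (Fin N) (Fin N) ℂ →ₗ[ℝ] ℂ :=
      { toFun := fun A => (Vᴴ * A * V) i j
        map_add' := fun A B => by simp [Matrix.mul_add, Matrix.add_mul]
        map_smul' := fun c A => by simp }
    have h1 : HasFDerivAt (fun ξ => (Vᴴ * H.toFun ξ * V) i j)
        (Λ.toContinuousLinearMap.comp (fderiv ℝ H.toFun ξ₀)) ξ₀ :=
      Λ.toContinuousLinearMap.hasFDerivAt.comp ξ₀
        (H.smooth.differentiable (by simp) ξ₀).hasFDerivAt
    -- The off-diagonal block and `Z` both vanish at `ξ₀`, so their product does not contribute to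
    -- the first derivative of `h`.
    have h2 : HasFDerivAt (fun ξ => ∑ a, M ξ (Sum.inl i) (Sum.inr a) * Z ξ a j)
        (∑ a : Fin k, (0 : Momentum →L[ℝ] ℂ)) ξ₀ := by
      refine HasFDerivAt.fun_sum fun a _ => hasFDerivAt_mul_of_eq_zero
        ((hMb ξ₀ _ _).differentiableAt (by simp))
        ((contDiffAt_matrix_entry hYM.self_of_nhds.1 a j).differentiableAt (by simp)) ?_ ?_
      · simp [hM₀]
      · simp [hZ, hY₀]
    have h3 : (fun ξ => h ξ i j) = fun ξ => (Vᴴ * H.toFun ξ * V) i j +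
        ∑ a, M ξ (Sum.inl i) (Sum.inr a) * Z ξ a j := by
      funext ξ
      simp only [hh, Matrix.add_apply, Matrix.mul_apply (M := (M ξ).toBlocks₁₂)]
      congr 1
    rw [h3, (h1.fun_add h2).fderiv]
    simp [Λ]
  refine ⟨Ω, fun ξ => (h ξ).trace.re / 2, fun ξ => (((h ξ 0 0 - h ξ 1 1) / 2) *
    ((h ξ 0 0 - h ξ 1 1) / 2) + h ξ 0 1 * h ξ 1 0).re, hΩo, hΩ₀, fun ξ hξ => ?_, fun ξ hξ => ?_,
    fun ξ hξ => ?_, ?_, ?_, fun v w => ?_, fun ξ hξ => ?_⟩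
  · refine ContDiffAt.contDiffWithinAt ?_
    simp only [trace_fin_two]
    exact (Complex.reCLM.contDiff.contDiffAt.comp ξ
      ((hent ξ hξ 0 0).add (hent ξ hξ 1 1))).div_const 2
  · exact (Complex.reCLM.contDiff.contDiffAt.comp ξ (hQs ξ hξ)).contDiffWithinAt
  · change 0 ≤ (_ : ℂ).re
    rw [hq ξ hξ]
    positivity
  · simp [hh₀]
  · have hd := fun i j => (hent ξ₀ hΩ₀ i j).differentiableAt (by simp)
    have hu := ((hd 0 0).fun_sub (hd 1 1)).mul_const 2⁻¹
    simp only [← div_eq_mul_inv] at hu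
    have h1 := (hasFDerivAt_mul_of_eq_zero hu hu (by simp [hh₀]) (by simp [hh₀])).fun_add
      (hasFDerivAt_mul_of_eq_zero (hd 0 1) (hd 1 0) (by simp [hh₀]) (by simp [hh₀]))
    refine (Complex.reCLM.hasFDerivAt.comp ξ₀ h1).fderiv.trans ?_
    ext v
    simp
  · have h2 := fun i j => (hent ξ₀ hΩ₀ i j).of_le (m := 2) ENat.LEInfty.out
    have hu2 := ((h2 0 0).sub (h2 1 1)).div_const 2
    have hu : ∀ v, fderiv ℝ (fun ξ => (h ξ 0 0 - h ξ 1 1) / 2) ξ₀ v =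
        ((Vᴴ * fderiv ℝ H.toFun ξ₀ v * V) 0 0 - (Vᴴ * fderiv ℝ H.toFun ξ₀ v * V) 1 1) / 2 := by
      intro v
      have hd := fun i j => (hent ξ₀ hΩ₀ i j).differentiableAt (by simp)
      simp only [div_eq_mul_inv]
      rw [fderiv_mul_const ((hd 0 0).fun_sub (hd 1 1)), fderiv_fun_sub (hd 0 0) (hd 1 1),
        ← hder, ← hder]
      simp [mul_comm]
    rw [fderiv_fderiv_re ((hu2.mul hu2).add ((h2 0 1).mul (h2 1 0))),
      fderiv_fderiv_add (hu2.mul hu2) ((h2 0 1).mul (h2 1 0)),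
      fderiv_fderiv_mul_of_eq_zero hu2 hu2 (by simp [hh₀]) (by simp [hh₀]),
      fderiv_fderiv_mul_of_eq_zero (h2 0 1) (h2 1 0) (by simp [hh₀]) (by simp [hh₀])]
    simp only [hu, hder]
    congr 1
    ring
  · obtain ⟨h1, h2⟩ := htd ξ hξ
    have h3 : 0 ≤ (H.eigenvalueAt n' ξ - H.eigenvalueAt n ξ) / 2 := by linarith [hle ξ]
    simp only [hq ξ hξ, h1, Real.sqrt_sq h3]
    norm_cast
    constructor <;> ring

end LocalForm

open Matrix Filter Topology

/-! ### Characterization of conical degeneracies by the first-order jet -/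

section Jets

variable {N : ℕ}

/-- `A` has an eigenvalue of multiplicity at least three. -/
def HasTripleEigenvalue (A : Matrix (Fin N) (Fin N) ℂ) : Prop :=
  ∃ (V : Matrix (Fin N) (Fin 3) ℂ) (c : ℂ), Vᴴ * V = 1 ∧ A * V = c • V

/-- `A` has two orthogonal planes of eigenvectors. -/
def HasTwoDoubleEigenvalues (A : Matrix (Fin N) (Fin N) ℂ) : Prop :=
  ∃ (V W : Matrix (Fin N) (Fin 2) ℂ) (c d : ℂ), Vᴴ * V = 1 ∧ Wᴴ * W = 1 ∧ Vᴴ * W = 0 ∧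
    A * V = c • V ∧ A * W = d • W

/-- A double eigenvalue of `A` does not split to first order in some direction, if `A` is
perturbed by `L`. -/
def HasFlatDirection (A : Matrix (Fin N) (Fin N) ℂ) (L : Momentum →L[ℝ] Matrix (Fin N) (Fin N) ℂ) :
    Prop :=
  ∃ (V : Matrix (Fin N) (Fin 2) ℂ) (v : Momentum) (c d : ℂ), Vᴴ * V = 1 ∧ A * V = c • V ∧
    v ≠ 0 ∧ Vᴴ * L v * V = d • 1

/-- The first-order jets `(A, L)` of families with a non-conical degeneracy. -/
def IsBadJet (A : Matrix (Fin N) (Fin N) ℂ) (L : Momentum →L[ℝ] Matrix (Fin N) (Fin N) ℂ) : Prop :=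
  HasTripleEigenvalue A ∨ HasTwoDoubleEigenvalues A ∨ HasFlatDirection A L

/-- The derivative of a map with Hermitian values has Hermitian values. -/
theorem isHermitian_fderiv {E ι : Type*} [NormedAddCommGroup E] [NormedSpace ℝ E] [Fintype ι]
    {f : E → Matrix ι ι ℂ} {x : E} (hd : DifferentiableAt ℝ f x) (hf : ∀ y, (f y).IsHermitian)
    (v : E) : (fderiv ℝ f x v).IsHermitian := by
  ext i j
  have h1 := hasFDerivAt_matrix_entry hd.hasFDerivAt i j
  have h2 := Complex.conjCLE.toContinuousLinearMap.hasFDerivAt.comp x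
    (hasFDerivAt_matrix_entry hd.hasFDerivAt j i)
  have e : (Complex.conjCLE.toContinuousLinearMap ∘ fun y => f y j i) = fun y => f y i j := by
    funext y
    exact (hf y).apply i j
  rw [e] at h2
  exact (congrArg (fun T : E →L[ℝ] ℂ => T v) (h2.unique h1))

theorem SmoothFamily.fderiv_isHermitian (H : SmoothFamily N) (ξ v : Momentum) :
    (fderiv ℝ H.toFun ξ v).IsHermitian :=
  isHermitian_fderiv (H.smooth.differentiable (by simp) ξ) H.isHermitian v

variable {A : Matrix (Fin N) (Fin N) ℂ}

theorem hasTripleEigenvalue_of_eq (hA : A.IsHermitian) {a b c : Fin N} (hab : a ≠ b) (hac : a ≠ c)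
    (hbc : b ≠ c) (h1 : eigenvalue hA a = eigenvalue hA b)
    (h2 : eigenvalue hA a = eigenvalue hA c) : HasTripleEigenvalue A := by
  obtain ⟨V, hV, hAV⟩ := exists_frame_of_injective hA ![a, b, c] (by
    intro i j hij
    fin_cases i <;> fin_cases j <;> simp_all)
  refine ⟨V, eigenvalue hA a, hV, ?_⟩
  have e : (diagonal fun i => (eigenvalue hA (![a, b, c] i) : ℂ)) =
      (eigenvalue hA a : ℂ) • (1 : Matrix (Fin 3) (Fin 3) ℂ) := by
    rw [smul_one_eq_diagonal]
    congr 1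
    funext i
    fin_cases i <;> simp [h1, ← h2]
  rw [hAV, e, Matrix.mul_smul, Matrix.mul_one]

theorem hasTwoDoubleEigenvalues_of_eq (hA : A.IsHermitian) {a b c d : Fin N} (hab : a ≠ b)
    (hac : a ≠ c) (had : a ≠ d) (hbc : b ≠ c) (hbd : b ≠ d) (hcd : c ≠ d)
    (h1 : eigenvalue hA a = eigenvalue hA b)
    (h2 : eigenvalue hA c = eigenvalue hA d) : HasTwoDoubleEigenvalues A := by
  obtain ⟨V, hV, hAV⟩ := exists_frame_of_injective hA (Sum.elim ![a, b] ![c, d]) (by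
    rintro (i | i) (j | j) hij <;> fin_cases i <;> fin_cases j <;> simp_all)
  obtain ⟨V, W, rfl⟩ : ∃ V₁ V₂ : Matrix (Fin N) (Fin 2) ℂ, V = fromCols V₁ V₂ :=
    ⟨_, _, (fromCols_toCols V).symm⟩
  have e : (diagonal fun i => (eigenvalue hA (Sum.elim ![a, b] ![c, d] i) : ℂ)) =
      fromBlocks ((eigenvalue hA a : ℂ) • (1 : Matrix (Fin 2) (Fin 2) ℂ)) 0 0
        ((eigenvalue hA c : ℂ) • (1 : Matrix (Fin 2) (Fin 2) ℂ)) := by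
    rw [smul_one_eq_diagonal, smul_one_eq_diagonal, fromBlocks_diagonal]
    congr 1
    funext i
    rcases i with i | i <;> fin_cases i <;> simp [h1, h2]
  rw [conjTranspose_fromCols_eq_fromRows_conjTranspose, fromRows_mul_fromCols,
    ← fromBlocks_one, fromBlocks_inj] at hV
  rw [e, mul_fromCols, fromCols_mul_fromBlocks, fromCols_inj.eq_iff] at hAV
  simp at hAV
  exact ⟨V, W, _, _, hV.1, hV.2.2.2, hV.2.1, hAV.1, hAV.2⟩

/-- Excluding triple and paired double eigenvalues gives the consecutive pair and the simplicity of
the others. If `v` lies in the kernel of the Hessian of `q`, testing against `w = v` makes a sum of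
squares vanish; then the compressed derivative is scalar and `v` is a flat direction unless it is
zero. -/
theorem SmoothFamily.isConicalAt_of_not_isBadJet (H : SmoothFamily N) {ξ : Momentum}
    (hbad : ¬ IsBadJet (H.toFun ξ) (fderiv ℝ H.toFun ξ)) (hdeg : H.HasDegeneracyAt ξ) :
    H.IsConicalAt ξ := by
  simp only [IsBadJet, not_or] at hbad
  obtain ⟨h3, h4, hflat⟩ := hbad
  have hA := H.isHermitian ξ
  have htriple : ∀ a b c : Fin N, a ≠ b → a ≠ c → b ≠ c →
      H.eigenvalueAt a ξ = H.eigenvalueAt b ξ → H.eigenvalueAt a ξ ≠ H.eigenvalueAt c ξ :=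
    fun a b c hab hac hbc h1 h2 => h3 (hasTripleEigenvalue_of_eq hA hab hac hbc h1 h2)
  have hmono : ∀ η, Monotone fun j => H.eigenvalueAt j η := fun η =>
    eigenvalue_monotone (H.isHermitian η)
  obtain ⟨n, n', hlt, heq⟩ : ∃ n n' : Fin N, n < n' ∧
      H.eigenvalueAt n ξ = H.eigenvalueAt n' ξ := by
    obtain ⟨j, k, hjk, h⟩ := hdeg
    rcases hjk.lt_or_gt with h' | h'
    exacts [⟨j, k, h', h⟩, ⟨k, j, h', h.symm⟩]
  have hsucc : (n' : ℕ) = n + 1 := by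
    by_contra hne
    have hlt' : (n : ℕ) < n' := hlt
    -- By monotonicity, an index strictly between `n` and `n'` would produce a triple eigenvalue.
    let c : Fin N := ⟨n + 1, by omega⟩
    have h1 : n < c := Fin.lt_def.mpr (Nat.lt_succ_self _)
    have h2 : c < n' := Fin.lt_def.mpr (by simp only [c]; omega)
    refine htriple n n' c hlt.ne h1.ne h2.ne' heq (le_antisymm (hmono ξ h1.le) ?_)
    rw [heq]
    exact hmono ξ h2.le
  have hsimple : ∀ j : Fin N, j ≠ n → j ≠ n' → ∀ k : Fin N, k ≠ j →
      H.eigenvalueAt k ξ ≠ H.eigenvalueAt j ξ := by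
    intro j hj hj' k hkj h
    by_cases hjn : H.eigenvalueAt n ξ = H.eigenvalueAt j ξ
    · exact htriple n n' j hlt.ne hj.symm hj'.symm heq hjn
    · have hkn : k ≠ n := by
        rintro rfl
        exact hjn h
      have hkn' : k ≠ n' := by
        rintro rfl
        exact hjn (heq.trans h)
      exact h4 (hasTwoDoubleEigenvalues_of_eq hA hlt.ne hkn.symm hj.symm hkn'.symm hj'.symm hkj
        heq h)
  obtain ⟨V, hV, hAV⟩ := exists_frame_of_injective hA ![n, n'] (by
    intro i j hij
    fin_cases i <;> fin_cases j <;> simp_all)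
  have hVA : H.toFun ξ * V = (H.eigenvalueAt n ξ : ℂ) • V := by
    have e : (diagonal fun i => (eigenvalue hA (![n, n'] i) : ℂ)) =
        (H.eigenvalueAt n ξ : ℂ) • (1 : Matrix (Fin 2) (Fin 2) ℂ) := by
      rw [smul_one_eq_diagonal]
      congr 1
      funext i
      fin_cases i
      · rfl
      · simp only [heq]
        rfl
    rw [hAV, e, Matrix.mul_smul, Matrix.mul_one]
  obtain ⟨Ω, ℓ, q, hΩ, hξ, hℓ, hq, hq0, hqξ, hdq, hhess, hform⟩ :=
    exists_local_form H ξ hlt.ne (fun η => hmono η hlt.le) rfl heq.symm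
      (fun j hj hj' h => hsimple j hj hj' n hj.symm h.symm) hV hVA
  refine ⟨n, n', hsucc, heq, hsimple, Ω, ℓ, q, hΩ, hξ, hℓ, hq, hq0, hqξ, ⟨hdq, fun v hv => ?_⟩,
    hform⟩
  by_contra hv0
  have hD : (Vᴴ * fderiv ℝ H.toFun ξ v * V).IsHermitian :=
    isHermitian_conjTranspose_mul_mul V (H.fderiv_isHermitian ξ v)
  have h := hv v
  rw [hhess] at h
  set D := Vᴴ * fderiv ℝ H.toFun ξ v * V with hDdef
  have e0 : (D 0 0).im = 0 := Complex.conj_eq_iff_im.mp (hD.apply 0 0)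
  have e1 : (D 1 1).im = 0 := Complex.conj_eq_iff_im.mp (hD.apply 1 1)
  have e2 : D 1 0 = star (D 0 1) := (hD.apply 1 0).symm
  have e3 : ((D 0 0).re - (D 1 1).re) ^ 2 / 2 + 2 * ((D 0 1).re ^ 2 + (D 0 1).im ^ 2) = 0 := by
    rw [← h, e2]
    simp [e0, e1]
    ring
  have s1 := sq_nonneg ((D 0 0).re - (D 1 1).re)
  have s2 := sq_nonneg (D 0 1).re
  have s3 := sq_nonneg (D 0 1).im
  have e4 : (D 0 0).re = (D 1 1).re :=
    sub_eq_zero.mp (pow_eq_zero_iff two_ne_zero |>.mp (by linarith))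
  have e5 : (D 0 1).re = 0 := pow_eq_zero_iff two_ne_zero |>.mp (by linarith)
  have e6 : (D 0 1).im = 0 := pow_eq_zero_iff two_ne_zero |>.mp (by linarith)
  have e7 : D 0 1 = 0 := Complex.ext e5 e6
  refine hflat ⟨V, v, _, D 0 0, hV, hVA, hv0, ?_⟩
  rw [← hDdef]
  ext i j
  fin_cases i <;> fin_cases j <;> simp [e7, e2]
  exact Complex.ext e4.symm (by rw [e0, e1])

/-- A bad jet has a repeated eigenvalue, so there is a cone, and the pair `n`, `n'` carries the only
repeated value, with multiplicity two. This rules out the first two kinds of bad jet; a flat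
direction would lie in the kernel of the Hessian. -/
theorem SmoothFamily.not_isBadJet_of_isConicalAt (H : SmoothFamily N) {ξ : Momentum}
    (hcon : H.HasDegeneracyAt ξ → H.IsConicalAt ξ) :
    ¬ IsBadJet (H.toFun ξ) (fderiv ℝ H.toFun ξ) := by
  have hA := H.isHermitian ξ
  have hdeg : IsBadJet (H.toFun ξ) (fderiv ℝ H.toFun ξ) → H.HasDegeneracyAt ξ := by
    have h1 : ∀ l : ℝ, 2 ≤ (Finset.univ.filter fun j => eigenvalue hA j = l).card →
        H.HasDegeneracyAt ξ := by
      intro l hl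
      obtain ⟨j, hj, k, hk, hjk⟩ := Finset.one_lt_card.mp hl
      exact ⟨j, k, hjk, (Finset.mem_filter.mp hj).2.trans (Finset.mem_filter.mp hk).2.symm⟩
    rintro (⟨V, c, hV, hAV⟩ | ⟨V, W, c, d, hV, hW, hVW, hAV, hAW⟩ | ⟨V, v, c, d, hV, hAV, hv, hd⟩)
      <;> obtain ⟨l, rfl⟩ := exists_real_of_mul_eq_smul hA hV hAV (by norm_num)
    · exact h1 l (le_trans (by norm_num) (le_card_eigenvalue_eq hA hV hAV))
    · exact h1 l (le_card_eigenvalue_eq hA hV hAV)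
    · exact h1 l (le_card_eigenvalue_eq hA hV hAV)
  intro hbad
  obtain ⟨n, n', hsucc, heq, hsimple, Ω, ℓ, q, hΩ, hξ, -, -, hq0, -, ⟨-, hnd⟩, hform⟩ :=
    hcon (hdeg hbad)
  have hlt : n < n' := Fin.lt_def.mpr (by omega)
  have key : ∀ l : ℝ, 2 ≤ (Finset.univ.filter fun j => eigenvalue hA j = l).card →
      H.eigenvalueAt n ξ = l ∧ ∀ i, eigenvalue hA i = l → i = n ∨ i = n' := by
    intro l hl
    obtain ⟨j, hj, k, hk, hjk⟩ := Finset.one_lt_card.mp hl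
    simp only [Finset.mem_filter, Finset.mem_univ, true_and] at hj hk
    have hsub : ∀ i, eigenvalue hA i = l → i = n ∨ i = n' := by
      intro i hi
      by_contra hne
      rw [not_or] at hne
      by_cases hij : j = i
      · exact hsimple i hne.1 hne.2 k (fun h => hjk (hij.trans h.symm)) (hk.trans hi.symm)
      · exact hsimple i hne.1 hne.2 j hij (hj.trans hi.symm)
    refine ⟨?_, hsub⟩
    rcases hsub j hj with h | h
    · rw [← h]
      exact hj
    · rw [heq, ← h]
      exact hj
  have hcard : ∀ l : ℝ, (Finset.univ.filter fun j => eigenvalue hA j = l).card ≤ 2 := by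
    intro l
    by_contra! h
    have h2 : (Finset.univ.filter fun j => eigenvalue hA j = l) ⊆ {n, n'} := fun i hi => by
      simpa using (key l h.le).2 i (Finset.mem_filter.mp hi).2
    have := (Finset.card_le_card h2).trans Finset.card_le_two
    omega
  rcases hbad with ⟨V, c, hV, hAV⟩ | ⟨V, W, c, d, hV, hW, hVW, hAV, hAW⟩ |
    ⟨V, v, c, d, hV, hAV, hv, hd⟩
  · obtain ⟨l, rfl⟩ := exists_real_of_mul_eq_smul hA hV hAV (by norm_num)
    have := le_card_eigenvalue_eq hA hV hAV
    have := hcard l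
    omega
  · obtain ⟨l, rfl⟩ := exists_real_of_mul_eq_smul hA hV hAV (by norm_num)
    obtain ⟨l', rfl⟩ := exists_real_of_mul_eq_smul hA hW hAW (by norm_num)
    obtain rfl : l = l' := (key l (le_card_eigenvalue_eq hA hV hAV)).1.symm.trans
      (key l' (le_card_eigenvalue_eq hA hW hAW)).1
    have hWV : Wᴴ * V = 0 := by
      rw [← conjTranspose_conjTranspose V, ← conjTranspose_mul, hVW, conjTranspose_zero]
    have hU : (fromCols V W)ᴴ * fromCols V W = 1 := by
      rw [conjTranspose_fromCols_eq_fromRows_conjTranspose, fromRows_mul_fromCols, hV, hW, hVW,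
        hWV, fromBlocks_one]
    have hAU : H.toFun ξ * fromCols V W = (l : ℂ) • fromCols V W := by
      rw [mul_fromCols, hAV, hAW]
      ext i (j | j) <;> simp
    -- Both planes belong to the same eigenvalue, so their four columns form one frame, against
    -- multiplicity at most two.
    let e := (finSumFinEquiv (m := 2) (n := 2)).symm
    have h4 := le_card_eigenvalue_eq hA (l := l) (V := (fromCols V W).submatrix id e)
      (by
        rw [conjTranspose_submatrix, ← submatrix_mul _ _ _ _ _ Function.bijective_id, hU]
        simp)
      (by
        rw [← submatrix_id_id (H.toFun ξ), ← submatrix_mul _ _ _ _ _ Function.bijective_id, hAU]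
        rfl)
    have := hcard l
    omega
  · obtain ⟨l, rfl⟩ := exists_real_of_mul_eq_smul hA hV hAV (by norm_num)
    obtain ⟨hl, hsub⟩ := key l (le_card_eigenvalue_eq hA hV hAV)
    obtain ⟨Ω', ℓ', q', hΩ', hξ', -, -, hq0', -, -, hhess, hform'⟩ :=
      exists_local_form H ξ hlt.ne (fun η => eigenvalue_monotone (H.isHermitian η) hlt.le) hl
        (heq.symm.trans hl) (fun j hj hj' h => (hsub j h).elim hj hj') hV hAV
    -- The function `q` of the cone is only known to exist. It agrees near `ξ` with that of the
    -- local form, since both square roots are half of the eigenvalue gap.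
    have hqq : q =ᶠ[𝓝 ξ] q' := by
      filter_upwards [hΩ.mem_nhds hξ, hΩ'.mem_nhds hξ'] with η h1 h2
      obtain ⟨a1, a2⟩ := hform η h1
      obtain ⟨b1, b2⟩ := hform' η h2
      have e : √(q η) = √(q' η) := by linarith
      exact (Real.sqrt_inj (hq0 η h1) (hq0' η h2)).mp e
    refine hv (hnd v fun w => ?_)
    rw [hqq.fderiv.fderiv_eq, hhess, hd]
    simp

end Jets

open Matrix Filter Topology

/-! ### Openness -/

section Openness

variable {N : ℕ}

/-- The projection along a compact factor is closed. This handles the existential quantifiers over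
frames and directions in the definition of bad jets. -/
theorem isClosed_exists_mem_of_isCompact {X Y : Type*} [TopologicalSpace X] [TopologicalSpace Y]
    {K : Set X} (hK : IsCompact K) {C : Set (X × Y)} (hC : IsClosed C) :
    IsClosed {y | ∃ x ∈ K, (x, y) ∈ C} := by
  have : CompactSpace K := isCompact_iff_compactSpace.mp hK
  have h := isClosedMap_snd_of_compactSpace (X := K) (Y := Y) _
    (hC.preimage (f := fun p : K × Y => ((p.1 : X), p.2)) (by fun_prop))
  convert h using 1
  ext y
  simp

theorem isCompact_frames (N m : ℕ) :
    IsCompact {V : Matrix (Fin N) (Fin m) ℂ | Vᴴ * V = 1} := by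
  have : ProperSpace (Matrix (Fin N) (Fin m) ℂ) := FiniteDimensional.proper ℂ _
  refine Metric.isCompact_of_isClosed_isBounded (isClosed_eq ?_ continuous_const) ?_
  · exact continuous_id.matrix_conjTranspose.matrix_mul continuous_id
  · refine isBounded_iff_forall_norm_le.mpr ⟨m, fun V hV => ?_⟩
    have h1 : ∑ j, ∑ i, ‖V i j‖ ^ 2 = m := by
      have h2 := congrArg (fun T => (trace T).re) (show Vᴴ * V = 1 from hV)
      simp only [trace, diag_apply, Matrix.mul_apply, conjTranspose_apply, Complex.re_sum] at h2
      have e : ∀ z : ℂ, (star z * z).re = ‖z‖ ^ 2 := fun z => by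
        rw [Complex.star_def, ← Complex.normSq_eq_conj_mul_self, Complex.normSq_eq_norm_sq]
        exact Complex.ofReal_re _
      simpa only [e, one_apply_eq, Complex.one_re, Finset.sum_const, Finset.card_univ,
        Fintype.card_fin, nsmul_eq_mul, mul_one] using h2
    have h3 : ‖V‖ ^ 2 = m := by
      rw [frobenius_norm_def, ← Real.sqrt_eq_rpow, Real.sq_sqrt (by positivity), Finset.sum_comm]
      exact_mod_cast h1
    -- The norm is `√m`, which is at most `m` for `m ≥ 1` and for `m = 0`.
    rcases Nat.eq_zero_or_pos m with rfl | hm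
    · have : ‖V‖ = 0 := by simpa using h3
      simp [this]
    · have h4 : (1 : ℝ) ≤ m := by exact_mod_cast hm
      nlinarith [norm_nonneg V]

/-- The scalar is determined by the frame, so the quantifier over the non-compact set of scalars
becomes a closed condition on `(A, V)`. -/
theorem mul_eq_smul_iff_of_frame {m : ℕ} {A : Matrix (Fin N) (Fin N) ℂ}
    {V : Matrix (Fin N) (Fin (m + 1)) ℂ} (hV : Vᴴ * V = 1) :
    (∃ c : ℂ, A * V = c • V) ↔ A * V = (Vᴴ * A * V) 0 0 • V := by
  refine ⟨?_, fun h => ⟨_, h⟩⟩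
  rintro ⟨c, hc⟩
  rw [Matrix.mul_assoc, hc, Matrix.mul_smul, hV]
  simp

theorem eq_smul_one_iff {m : ℕ} {B : Matrix (Fin (m + 1)) (Fin (m + 1)) ℂ} :
    (∃ c : ℂ, B = c • 1) ↔ B = B 0 0 • 1 := by
  refine ⟨?_, fun h => ⟨_, h⟩⟩
  rintro ⟨c, rfl⟩
  simp

theorem isClosed_hasTripleEigenvalue :
    IsClosed {A : Matrix (Fin N) (Fin N) ℂ | HasTripleEigenvalue A} := by
  have hC : IsClosed {p : Matrix (Fin N) (Fin 3) ℂ × Matrix (Fin N) (Fin N) ℂ |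
      p.2 * p.1 = (p.1ᴴ * p.2 * p.1) 0 0 • p.1} := by
    have h1 : Continuous fun p : Matrix (Fin N) (Fin 3) ℂ × Matrix (Fin N) (Fin N) ℂ =>
      p.1 := continuous_fst
    have h2 : Continuous fun p : Matrix (Fin N) (Fin 3) ℂ × Matrix (Fin N) (Fin N) ℂ =>
      p.2 := continuous_snd
    exact isClosed_eq (h2.matrix_mul h1)
      ((((h1.matrix_conjTranspose.matrix_mul h2).matrix_mul h1).matrix_elem 0 0).smul h1)
  convert isClosed_exists_mem_of_isCompact (isCompact_frames N 3) hC using 1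
  ext A
  simp only [HasTripleEigenvalue, Set.mem_ofPred_eq]
  refine exists_congr fun V => ?_
  rw [exists_and_left]
  exact and_congr_right fun hV => mul_eq_smul_iff_of_frame hV

theorem isClosed_hasTwoDoubleEigenvalues :
    IsClosed {A : Matrix (Fin N) (Fin N) ℂ | HasTwoDoubleEigenvalues A} := by
  have hC : IsClosed {p : (Matrix (Fin N) (Fin 2) ℂ × Matrix (Fin N) (Fin 2) ℂ) ×
      Matrix (Fin N) (Fin N) ℂ | p.1.1ᴴ * p.1.2 = 0 ∧
        p.2 * p.1.1 = (p.1.1ᴴ * p.2 * p.1.1) 0 0 • p.1.1 ∧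
        p.2 * p.1.2 = (p.1.2ᴴ * p.2 * p.1.2) 0 0 • p.1.2} := by
    have h1 : Continuous fun p : (Matrix (Fin N) (Fin 2) ℂ × Matrix (Fin N) (Fin 2) ℂ) ×
      Matrix (Fin N) (Fin N) ℂ => p.1.1 := continuous_fst.fst
    have h2 : Continuous fun p : (Matrix (Fin N) (Fin 2) ℂ × Matrix (Fin N) (Fin 2) ℂ) ×
      Matrix (Fin N) (Fin N) ℂ => p.1.2 := continuous_fst.snd
    have h3 : Continuous fun p : (Matrix (Fin N) (Fin 2) ℂ × Matrix (Fin N) (Fin 2) ℂ) ×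
      Matrix (Fin N) (Fin N) ℂ => p.2 := continuous_snd
    exact (isClosed_eq (h1.matrix_conjTranspose.matrix_mul h2) continuous_const).inter
      ((isClosed_eq (h3.matrix_mul h1)
        ((((h1.matrix_conjTranspose.matrix_mul h3).matrix_mul h1).matrix_elem 0 0).smul h1)).inter
      (isClosed_eq (h3.matrix_mul h2)
        ((((h2.matrix_conjTranspose.matrix_mul h3).matrix_mul h2).matrix_elem 0 0).smul h2)))
  convert isClosed_exists_mem_of_isCompact
    ((isCompact_frames N 2).prod (isCompact_frames N 2)) hC using 1
  ext A
  simp only [HasTwoDoubleEigenvalues, Set.mem_ofPred_eq, Prod.exists, Set.mem_prod]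
  refine exists_congr fun V => exists_congr fun W => ?_
  simp only [exists_and_left, exists_and_right]
  rw [and_assoc]
  refine and_congr_right fun hV => and_congr_right fun hW => and_congr_right fun _ =>
    and_congr (mul_eq_smul_iff_of_frame hV) (mul_eq_smul_iff_of_frame hW)

theorem isClosed_hasFlatDirection :
    IsClosed {p : Matrix (Fin N) (Fin N) ℂ × (Momentum →L[ℝ] Matrix (Fin N) (Fin N) ℂ) |
      HasFlatDirection p.1 p.2} := by
  have hC : IsClosed {p : (Matrix (Fin N) (Fin 2) ℂ × Momentum) ×
      (Matrix (Fin N) (Fin N) ℂ × (Momentum →L[ℝ] Matrix (Fin N) (Fin N) ℂ)) |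
        p.2.1 * p.1.1 = (p.1.1ᴴ * p.2.1 * p.1.1) 0 0 • p.1.1 ∧
        p.1.1ᴴ * p.2.2 p.1.2 * p.1.1 = (p.1.1ᴴ * p.2.2 p.1.2 * p.1.1) 0 0 • 1} := by
    have h1 : Continuous fun p : (Matrix (Fin N) (Fin 2) ℂ × Momentum) ×
      (Matrix (Fin N) (Fin N) ℂ × (Momentum →L[ℝ] Matrix (Fin N) (Fin N) ℂ)) => p.1.1 :=
      continuous_fst.fst
    have h3 : Continuous fun p : (Matrix (Fin N) (Fin 2) ℂ × Momentum) ×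
      (Matrix (Fin N) (Fin N) ℂ × (Momentum →L[ℝ] Matrix (Fin N) (Fin N) ℂ)) => p.2.1 :=
      continuous_snd.fst
    have h4 : Continuous fun p : (Matrix (Fin N) (Fin 2) ℂ × Momentum) ×
      (Matrix (Fin N) (Fin N) ℂ × (Momentum →L[ℝ] Matrix (Fin N) (Fin N) ℂ)) =>
      p.2.2 p.1.2 := continuous_snd.snd.clm_apply continuous_fst.snd
    have h5 := (h1.matrix_conjTranspose.matrix_mul h4).matrix_mul h1
    exact (isClosed_eq (h3.matrix_mul h1)
        ((((h1.matrix_conjTranspose.matrix_mul h3).matrix_mul h1).matrix_elem 0 0).smul h1)).inter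
      (isClosed_eq h5 ((h5.matrix_elem 0 0).smul continuous_const))
  convert isClosed_exists_mem_of_isCompact
    ((isCompact_frames N 2).prod (isCompact_sphere (0 : Momentum) 1)) hC using 1
  ext ⟨A, L⟩
  simp only [HasFlatDirection, Set.mem_ofPred_eq, Prod.exists, Set.mem_prod,
    mem_sphere_zero_iff_norm]
  constructor
  · rintro ⟨V, v, c, d, hV, hA, hv, hd⟩
    -- The condition is homogeneous in `v`, so `v ≠ 0` may be replaced by the compact condition `‖v‖
    -- = 1`.
    refine ⟨V, ‖v‖⁻¹ • v, ⟨hV, norm_smul_inv_norm hv⟩,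
      (mul_eq_smul_iff_of_frame hV).mp ⟨c, hA⟩, eq_smul_one_iff.mp ⟨(‖v‖⁻¹ : ℝ) • d, ?_⟩⟩
    rw [map_smul, Matrix.mul_smul, Matrix.smul_mul, hd, smul_assoc]
  · rintro ⟨V, v, ⟨hV, hv⟩, hA, hd⟩
    exact ⟨V, v, _, _, hV, hA, by
      rintro rfl
      simp at hv, hd⟩

theorem isClosed_isBadJet :
    IsClosed {p : Matrix (Fin N) (Fin N) ℂ × (Momentum →L[ℝ] Matrix (Fin N) (Fin N) ℂ) |
      IsBadJet p.1 p.2} :=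
  (isClosed_hasTripleEigenvalue.preimage continuous_fst).union
    ((isClosed_hasTwoDoubleEigenvalues.preimage continuous_fst).union isClosed_hasFlatDirection)

theorem Hamiltonian.hasOnlyConicalDegeneracies_iff (A : Hamiltonian N) :
    A.HasOnlyConicalDegeneracies ↔
      ∀ ξ, ¬ IsBadJet (A.bloch.toFun ξ) (fderiv ℝ A.bloch.toFun ξ) :=
  ⟨fun h ξ => A.bloch.not_isBadJet_of_isConicalAt (h ξ),
    fun h ξ => A.bloch.isConicalAt_of_not_isBadJet (h ξ)⟩

/-- The first-order jets of families which are close to each other are close. -/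
theorem SmoothFamily.exists_dist_jet_lt (H : SmoothFamily N) {ε : ℝ} (hε : 0 < ε) :
    ∃ δ > 0, ∀ K : SmoothFamily N, dist K H < δ → ∀ ξ,
      dist (K.toFun ξ, fderiv ℝ K.toFun ξ) (H.toFun ξ, fderiv ℝ H.toFun ξ) < ε := by
  -- The term of index 1 of the series has weight `1 / 2`, and `t / (1 + t)` is increasing. The `C¹`
  -- norm bounds values and first derivatives together.
  refine ⟨(1 / 2) * (ε / (1 + ε)), by positivity, fun K hK ξ => ?_⟩
  have hc := cNorm_nonneg 1 (K.toFun - H.toFun)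
  have h1 : (1 / 2 : ℝ) ^ 1 * (cNorm 1 (K.toFun - H.toFun) / (1 + cNorm 1 (K.toFun - H.toFun))) ≤
      dist K H := (summable_distance K H).le_tsum 1 fun k _ => by
    have := cNorm_nonneg k (K.toFun - H.toFun)
    positivity
  have h2 : cNorm 1 (K.toFun - H.toFun) < ε := by
    have h3 := h1.trans_lt hK
    rw [pow_one, mul_lt_mul_iff_right₀ (by norm_num), div_lt_div_iff₀ (by positivity)
      (by positivity)] at h3
    linarith
  have h4 := (le_ciSup (bddAbove_sub K H 1) ξ).trans_lt h2
  have h5 : fderiv ℝ (K.toFun - H.toFun) ξ = fderiv ℝ K.toFun ξ - fderiv ℝ H.toFun ξ :=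
    fderiv_sub (K.smooth.differentiable (by simp) ξ) (H.smooth.differentiable (by simp) ξ)
  rw [norm_iteratedFDeriv_one, h5] at h4
  rw [Prod.dist_eq, dist_eq_norm, dist_eq_norm, max_lt_iff]
  constructor
  · exact lt_of_le_of_lt (le_add_of_nonneg_right (norm_nonneg _)) h4
  · exact lt_of_le_of_lt (le_add_of_nonneg_left (norm_nonneg _)) h4

/-- The first-order jets of a family over the torus are contained in a compact set, namely the
jets over a ball. -/
theorem SmoothFamily.exists_mem_closedBall_jet_eq (H : SmoothFamily N) (ξ : Momentum) :
    ∃ η ∈ Metric.closedBall (0 : Momentum) 20,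
      (H.toFun η, fderiv ℝ H.toFun η) = (H.toFun ξ, fderiv ℝ H.toFun ξ) := by
  obtain ⟨m, hm⟩ := exists_period_add_mem ξ
  refine ⟨_, hm, ?_⟩
  have h := fderiv_comp_add_right (𝕜 := ℝ) (f := H.toFun) (x := ξ) (period m)
  simp only [H.periodic] at h
  rw [H.periodic, h]

theorem isOpen_hasOnlyConicalDegeneracies (N : ℕ) :
    IsOpen {A : Hamiltonian N | A.HasOnlyConicalDegeneracies} := by
  refine Metric.isOpen_iff.mpr fun A hA => ?_
  have hA' := A.hasOnlyConicalDegeneracies_iff.mp hA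
  let J := fun ξ => (A.bloch.toFun ξ, fderiv ℝ A.bloch.toFun ξ)
  have hJ : Continuous J :=
    A.bloch.smooth.continuous.prodMk (A.bloch.smooth.continuous_fderiv (by simp))
  have hK : IsCompact (J '' Metric.closedBall 0 20) :=
    (isCompact_closedBall (0 : Momentum) 20).image hJ
  obtain ⟨ε, hε, hεU⟩ := hK.exists_thickening_subset_open
    (isClosed_isBadJet (N := N)).isOpen_compl (by
      rintro _ ⟨ξ, -, rfl⟩
      exact hA' ξ)
  obtain ⟨δ, hδ, hδε⟩ := A.bloch.exists_dist_jet_lt hε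
  refine ⟨δ, hδ, fun B hB => B.hasOnlyConicalDegeneracies_iff.mpr fun ξ => ?_⟩
  obtain ⟨η, hη, he⟩ := A.bloch.exists_mem_closedBall_jet_eq ξ
  have hm : (B.bloch.toFun ξ, fderiv ℝ B.bloch.toFun ξ) ∈
      Metric.thickening ε (J '' Metric.closedBall 0 20) := by
    refine Metric.mem_thickening_iff.mpr ⟨_, ⟨η, hη, rfl⟩, ?_⟩
    simp only [J, he]
    exact hδε B.bloch hB ξ
  exact hεU hm

end Openness

open Matrix MeasureTheory Module

/-! ### Real coordinates on Hermitian matrices -/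

section Coordinates

variable {ι : Type*}

/-- Real coordinates of a matrix, which are linear coordinates on the Hermitian matrices. -/
def realOf : Matrix ι ι ℂ →ₗ[ℝ] (ι → ι → ℝ) where
  toFun A i j := (A i j).re + (A i j).im
  map_add' A B := by
    funext i j
    simp
    ring
  map_smul' c A := by
    funext i j
    simp
    ring

/-- The Hermitian matrix with given real coordinates. -/
noncomputable def hermOf : (ι → ι → ℝ) →ₗ[ℝ] Matrix ι ι ℂ where
  toFun p := Matrix.of fun i j => ⟨(p i j + p j i) / 2, (p i j - p j i) / 2⟩
  map_add' p q := by
    ext i j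
    apply Complex.ext <;> simp <;> ring
  map_smul' c p := by
    ext i j
    apply Complex.ext <;> simp <;> ring

theorem realOf_hermOf (p : ι → ι → ℝ) : realOf (hermOf p) = p := by
  funext i j
  simp only [realOf, hermOf, LinearMap.coe_mk, AddHom.coe_mk, of_apply]
  ring

theorem hermOf_isHermitian (p : ι → ι → ℝ) : (hermOf p).IsHermitian := by
  ext i j
  apply Complex.ext <;> simp [hermOf] <;> ring

/-- For a Hermitian matrix the coordinates at `(i, j)` and `(j, i)` are `re + im` and `re - im` of
one entry, which recovers it. -/
theorem hermOf_realOf {A : Matrix ι ι ℂ} (hA : A.IsHermitian) : hermOf (realOf A) = A := by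
  ext i j
  have h := hA.apply j i
  have h1 : (A j i).re = (A i j).re := by rw [← h]; simp
  have h2 : (A j i).im = -(A i j).im := by rw [← h]; simp
  apply Complex.ext
  · simp [hermOf, realOf, h1, h2]
    ring
  · simp [hermOf, realOf, h1, h2]

theorem eq_of_realOf_eq {A B : Matrix ι ι ℂ} (hA : A.IsHermitian) (hB : B.IsHermitian)
    (h : realOf A = realOf B) : A = B := by
  rw [← hermOf_realOf hA, ← hermOf_realOf hB, h]

end Coordinates

/-! ### Differentiability of matrix operations -/

section Differentiability

variable {E : Type*} [NormedAddCommGroup E] [NormedSpace ℝ E]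
  {m n l : Type*} [Fintype m] [Fintype n] [Fintype l]

theorem differentiable_matrix_mul {F : E → Matrix m n ℂ} {G : E → Matrix n l ℂ}
    (hF : Differentiable ℝ F) (hG : Differentiable ℝ G) : Differentiable ℝ fun y => F y * G y := by
  refine differentiable_matrix.mpr fun i j => ?_
  simp only [Matrix.mul_apply]
  exact Differentiable.fun_sum fun k _ =>
    (differentiable_matrix.mp hF i k).mul (differentiable_matrix.mp hG k j)

theorem differentiable_conjTranspose {F : E → Matrix m n ℂ} (hF : Differentiable ℝ F) :
    Differentiable ℝ fun y => (F y)ᴴ :=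
  differentiable_matrix.mpr fun i j =>
    Complex.conjCLE.differentiable.comp (differentiable_matrix.mp hF j i)

theorem differentiable_submatrix {F : E → Matrix m n ℂ} (hF : Differentiable ℝ F) {m' n' : Type*}
    [Fintype m'] [Fintype n'] (e : m' → m) (f : n' → n) :
    Differentiable ℝ fun y => (F y).submatrix e f :=
  differentiable_matrix.mpr fun i j => differentiable_matrix.mp hF (e i) (f j)

theorem differentiable_hermOf {F : E → (m → m → ℝ)} (hF : Differentiable ℝ F) :
    Differentiable ℝ fun y => hermOf (F y) :=
  (LinearMap.toContinuousLinearMap (hermOf (ι := m))).differentiable.comp hF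

end Differentiability

/-! ### Matrices with a given plane of eigenvectors -/

section Strata

variable {κ : Type*} [Fintype κ] [DecidableEq κ]

/-- The columns of this matrix span a plane; the planes of this form are the graphs. -/
def graphFrame (Z : Matrix κ (Fin 2) ℂ) : Matrix (Fin 2 ⊕ κ) (Fin 2) ℂ := fromRows 1 Z

/-- The annihilator of the graph of `Z`. -/
def graphCoframe (Z : Matrix κ (Fin 2) ℂ) : Matrix κ (Fin 2 ⊕ κ) ℂ := fromCols (-Z) 1

/-- The Hermitian matrices for which the graph of `Z` consists of eigenvectors with
eigenvalue `l`. -/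
noncomputable def graphStratum (l : ℝ) (Z : Matrix κ (Fin 2) ℂ) (P : Matrix κ κ ℂ) :
    Matrix (Fin 2 ⊕ κ) (Fin 2 ⊕ κ) ℂ :=
  (l : ℂ) • 1 + (graphCoframe Z)ᴴ * P * graphCoframe Z

theorem graphCoframe_mul_graphFrame (Z Z' : Matrix κ (Fin 2) ℂ) :
    graphCoframe Z * graphFrame Z' = Z' - Z := by
  simp [graphCoframe, graphFrame, fromCols_mul_fromRows, sub_eq_neg_add]

theorem graphStratum_isHermitian (l : ℝ) (Z : Matrix κ (Fin 2) ℂ) {P : Matrix κ κ ℂ}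
    (hP : P.IsHermitian) : (graphStratum l Z P).IsHermitian := by
  refine IsHermitian.add ?_ (isHermitian_conjTranspose_mul_mul _ hP)
  simp [IsHermitian]

/-- `B = A - l` kills the graph, which expresses its first block column by the second; being
Hermitian, `B` is then determined by its lower-right block `d`: the other blocks are `-(d * Z)`,
`-(Zᴴ * d)` and `Zᴴ * d * Z`. -/
theorem eq_graphStratum {A : Matrix (Fin 2 ⊕ κ) (Fin 2 ⊕ κ) ℂ} (hA : A.IsHermitian) {l : ℝ}
    {Z : Matrix κ (Fin 2) ℂ} (h : A * graphFrame Z = (l : ℂ) • graphFrame Z) :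
    A = graphStratum l Z (A - (l : ℂ) • 1).toBlocks₂₂ := by
  set B := A - (l : ℂ) • 1 with hB
  have hBh : B.IsHermitian := hA.sub (by simp [IsHermitian])
  have hBZ : B * graphFrame Z = 0 := by rw [hB, Matrix.sub_mul, h]; simp
  suffices hs : B = (graphCoframe Z)ᴴ * B.toBlocks₂₂ * graphCoframe Z by
    rw [graphStratum, ← hs, hB]
    abel
  obtain ⟨a, b, c, d, hBb⟩ : ∃ a b c d, B = fromBlocks a b c d :=
    ⟨_, _, _, _, (fromBlocks_toBlocks B).symm⟩
  rw [hBb] at hBh hBZ ⊢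
  obtain ⟨h1, h2, h3, h4⟩ := isHermitian_fromBlocks_iff.mp hBh
  rw [graphFrame, fromBlocks_mul_fromRows, ← fromRows_zero, fromRows_inj.eq_iff] at hBZ
  simp only [Matrix.mul_one] at hBZ
  have hc : c = -(d * Z) := eq_neg_of_add_eq_zero_left hBZ.2
  have hb : b = -(Zᴴ * d) := by
    rw [← h3, hc, conjTranspose_neg, conjTranspose_mul, h4.eq]
  have ha : a = Zᴴ * d * Z := by
    rw [eq_neg_of_add_eq_zero_left hBZ.1, hb, Matrix.neg_mul, neg_neg]
  rw [toBlocks_fromBlocks₂₂, graphCoframe, conjTranspose_fromCols_eq_fromRows_conjTranspose,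
    fromRows_mul, fromRows_mul_fromCols, ha, hb, hc]
  simp

/-- Two linearly independent vectors have a non-vanishing minor. -/
theorem exists_equiv_isUnit_det {ι : Type*} [Fintype ι] [DecidableEq ι] {V : Matrix ι (Fin 2) ℂ}
    (hV : ∀ c, V *ᵥ c = 0 → c = 0) :
    ∃ (k : ℕ) (e : Fin 2 ⊕ Fin k ≃ ι), IsUnit (V.submatrix (e ∘ Sum.inl) id).det := by
  obtain ⟨a, b, hab⟩ : ∃ a b, V a 0 * V b 1 - V a 1 * V b 0 ≠ 0 := by
    by_contra! h
    -- If all minors vanish, then `(-V a 1, V a 0)` lies in the kernel of `V`. Hence the first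
    -- column is zero, and `(1, 0)` is in the kernel.
    have h0 : ∀ a, V a 0 = 0 := by
      intro a
      have h1 := hV ![-V a 1, V a 0] (by
        funext b
        simp only [mulVec, dotProduct, Fin.sum_univ_two, cons_val_zero, cons_val_one,
          Pi.zero_apply]
        linear_combination h a b)
      exact congrFun h1 1
    have h1 := hV ![1, 0] (by
      funext b
      simp [mulVec, dotProduct, Fin.sum_univ_two, h0])
    exact one_ne_zero (congrFun h1 0)
  have hne : a ≠ b := by
    rintro rfl
    exact hab (by ring)
  have hcard : 2 ≤ Fintype.card ι := Fintype.one_lt_card_iff.mpr ⟨a, b, hne⟩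
  let e₀ : Fin 2 ⊕ Fin (Fintype.card ι - 2) ≃ ι :=
    Fintype.equivOfCardEq (by simp; omega)
  let e₁ := e₀.trans (Equiv.swap (e₀ (Sum.inl 0)) a)
  let e := e₁.trans (Equiv.swap (e₁ (Sum.inl 1)) b)
  have h1 : e₁ (Sum.inl 0) = a := by simp [e₁]
  have h2 : e (Sum.inl 0) = a := by
    rw [show e (Sum.inl 0) = Equiv.swap (e₁ (Sum.inl 1)) b (e₁ (Sum.inl 0)) from rfl, h1]
    refine Equiv.swap_apply_of_ne_of_ne ?_ hne
    rw [← h1]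
    exact fun h => by simpa using e₁.injective h
  have h3 : e (Sum.inl 1) = b := by simp [e]
  refine ⟨_, e, ?_⟩
  rw [det_fin_two, isUnit_iff_ne_zero]
  simpa [h2, h3] using hab

/-- In suitable coordinates, a plane is a graph. -/
theorem exists_equiv_eq_graphFrame_mul {ι : Type*} [Fintype ι] [DecidableEq ι]
    {V : Matrix ι (Fin 2) ℂ} (hV : ∀ c, V *ᵥ c = 0 → c = 0) :
    ∃ (k : ℕ) (e : Fin 2 ⊕ Fin k ≃ ι) (Z : Matrix (Fin k) (Fin 2) ℂ) (T : Matrix (Fin 2) (Fin 2) ℂ),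
      IsUnit T.det ∧ V.submatrix e id = graphFrame Z * T := by
  obtain ⟨k, e, he⟩ := exists_equiv_isUnit_det hV
  refine ⟨k, e, V.submatrix (e ∘ Sum.inr) id * (V.submatrix (e ∘ Sum.inl) id)⁻¹, _, he, ?_⟩
  rw [graphFrame, fromRows_mul, Matrix.one_mul, Matrix.mul_assoc, nonsing_inv_mul _ he,
    Matrix.mul_one]
  ext (i | i) j <;> rfl

theorem mul_eq_smul_of_mul_isUnit {ι : Type*} [Fintype ι] {A : Matrix ι ι ℂ} {c : ℂ}
    {F : Matrix ι (Fin 2) ℂ} {T : Matrix (Fin 2) (Fin 2) ℂ} (hT : IsUnit T.det)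
    (h : A * (F * T) = c • (F * T)) : A * F = c • F := by
  have h1 := congrArg (· * T⁻¹) h
  simpa [Matrix.mul_assoc, mul_nonsing_inv _ hT] using h1

theorem eq_zero_of_mulVec_eq_zero {ι : Type*} [Fintype ι] {m : ℕ} {V : Matrix ι (Fin m) ℂ}
    (hV : Vᴴ * V = 1) (c : Fin m → ℂ) (h : V *ᵥ c = 0) : c = 0 := by
  rw [← one_mulVec c, ← hV, ← mulVec_mulVec, h, mulVec_zero]

end Strata

open Matrix MeasureTheory Module

/-! ### Transversality to the matrices with a double eigenvalue -/

section Transversality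

/-- Parameters `(l, Z, p, ξ)` for a Hermitian matrix with a double eigenvalue and a
quasi-momentum. -/
abbrev StratumParams (k : ℕ) : Type :=
  ℝ × Matrix (Fin k) (Fin 2) ℂ × (Fin k → Fin k → ℝ) × Momentum

variable {k : ℕ} {G : Momentum → Matrix (Fin 2 ⊕ Fin k) (Fin 2 ⊕ Fin k) ℂ}

/-- The difference between a matrix with a double eigenvalue and a member of the family `G`. -/
noncomputable def stratumMap (G : Momentum → Matrix (Fin 2 ⊕ Fin k) (Fin 2 ⊕ Fin k) ℂ)
    (x : StratumParams k) : Matrix (Fin 2 ⊕ Fin k) (Fin 2 ⊕ Fin k) ℂ :=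
  graphStratum x.1 x.2.1 (hermOf x.2.2.1) - G x.2.2.2

theorem differentiable_graphCoframe {E : Type*} [NormedAddCommGroup E] [NormedSpace ℝ E]
    {Z : E → Matrix (Fin k) (Fin 2) ℂ} (hZ : Differentiable ℝ Z) :
    Differentiable ℝ fun x => graphCoframe (Z x) := by
  refine differentiable_matrix.mpr fun i j => ?_
  rcases j with j | j
  · exact (differentiable_matrix.mp hZ i j).neg
  · exact differentiable_const _

theorem differentiable_graphStratum {E : Type*} [NormedAddCommGroup E] [NormedSpace ℝ E]
    {l : E → ℝ} {Z : E → Matrix (Fin k) (Fin 2) ℂ} {P : E → Matrix (Fin k) (Fin k) ℂ}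
    (hl : Differentiable ℝ l) (hZ : Differentiable ℝ Z) (hP : Differentiable ℝ P) :
    Differentiable ℝ fun x => graphStratum (l x) (Z x) (P x) := by
  have hC := differentiable_graphCoframe hZ
  refine Differentiable.add ?_ (differentiable_matrix_mul (differentiable_matrix_mul
    (differentiable_conjTranspose hC) hP) hC)
  exact (Complex.ofRealCLM.differentiable.comp hl).smul_const _

theorem differentiable_stratumMap (hG : Differentiable ℝ G) :
    Differentiable ℝ (stratumMap G) :=
  (differentiable_graphStratum differentiable_fst differentiable_snd.fst
    (differentiable_hermOf differentiable_snd.snd.fst)).sub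
    (hG.comp differentiable_snd.snd.snd)

theorem stratumMap_isHermitian (hG : ∀ ξ, (G ξ).IsHermitian) (x : StratumParams k) :
    (stratumMap G x).IsHermitian :=
  (graphStratum_isHermitian _ _ (hermOf_isHermitian _)).sub (hG _)

/-- With `F` the graph frame and `C` the coframe, the sandwiched term `Fᴴ Cᴴ P C B` is a product of
`(C F)ᴴ` and `P C B`, both zero at `x`. Variations of the plane and of `P` are therefore invisible,
and only those of `l` and `ξ` remain. It is used with `B = F` and with `B` a further eigenvector. -/
theorem graphFrame_mul_fderiv_stratumMap_mul (hG : Differentiable ℝ G) (x d : StratumParams k)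
    {m : ℕ} (B : Matrix (Fin 2 ⊕ Fin k) (Fin m) ℂ)
    (hB : hermOf x.2.2.1 * (graphCoframe x.2.1 * B) = 0) :
    (graphFrame x.2.1)ᴴ * fderiv ℝ (stratumMap G) x d * B =
      (d.1 : ℂ) • ((graphFrame x.2.1)ᴴ * B) -
        (graphFrame x.2.1)ᴴ * fderiv ℝ G x.2.2.2 d.2.2.2 * B := by
  ext i j
  let Λ : Matrix (Fin 2 ⊕ Fin k) (Fin 2 ⊕ Fin k) ℂ →ₗ[ℝ] ℂ :=
    { toFun := fun A => ((graphFrame x.2.1)ᴴ * A * B) i j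
      map_add' := fun A A' => by simp [Matrix.mul_add, Matrix.add_mul]
      map_smul' := fun c A => by simp }
  have hΛ : ∀ A, Λ.toContinuousLinearMap A = ((graphFrame x.2.1)ᴴ * A * B) i j := fun A => rfl
  have h1 : HasFDerivAt (fun y => ((graphFrame x.2.1)ᴴ * stratumMap G y * B) i j)
      (Λ.toContinuousLinearMap.comp (fderiv ℝ (stratumMap G) x)) x :=
    Λ.toContinuousLinearMap.hasFDerivAt.comp x (differentiable_stratumMap hG x).hasFDerivAt
  let π : StratumParams k →L[ℝ] Momentum := (ContinuousLinearMap.snd ℝ _ _).comp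
    ((ContinuousLinearMap.snd ℝ _ _).comp (ContinuousLinearMap.snd ℝ _ _))
  have h2 : HasFDerivAt (fun y : StratumParams k =>
      ((graphFrame x.2.1)ᴴ * G y.2.2.2 * B) i j)
      (Λ.toContinuousLinearMap.comp ((fderiv ℝ G x.2.2.2).comp π)) x :=
    Λ.toContinuousLinearMap.hasFDerivAt.comp x
      (HasFDerivAt.comp x (hG x.2.2.2).hasFDerivAt π.hasFDerivAt)
  have h3 : HasFDerivAt (fun y : StratumParams k =>
      (y.1 : ℂ) * ((graphFrame x.2.1)ᴴ * B) i j)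
      ((Complex.ofRealCLM.comp (ContinuousLinearMap.fst ℝ ℝ _)).smulRight
        (((graphFrame x.2.1)ᴴ * B) i j)) x :=
    ((Complex.ofRealCLM.comp (ContinuousLinearMap.fst ℝ ℝ
      (Matrix (Fin k) (Fin 2) ℂ × (Fin k → Fin k → ℝ) × Momentum))).smulRight
        (((graphFrame x.2.1)ᴴ * B) i j)).hasFDerivAt
  have hd1 : Differentiable ℝ fun y : StratumParams k =>
      (graphCoframe y.2.1 * graphFrame x.2.1)ᴴ :=
    differentiable_conjTranspose (differentiable_matrix_mul
      (differentiable_graphCoframe differentiable_snd.fst) (differentiable_const _))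
  have hd2 : Differentiable ℝ fun y : StratumParams k =>
      hermOf y.2.2.1 * (graphCoframe y.2.1 * B) :=
    differentiable_matrix_mul (differentiable_hermOf differentiable_snd.snd.fst)
      (differentiable_matrix_mul (differentiable_graphCoframe differentiable_snd.fst)
        (differentiable_const _))
  have h4 : HasFDerivAt (fun y : StratumParams k =>
      ∑ a, (graphCoframe y.2.1 * graphFrame x.2.1)ᴴ i a *
        (hermOf y.2.2.1 * (graphCoframe y.2.1 * B)) a j)
      (∑ a : Fin k, (0 : StratumParams k →L[ℝ] ℂ)) x := by
    refine HasFDerivAt.fun_sum fun a _ => hasFDerivAt_mul_of_eq_zero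
      (differentiable_matrix.mp hd1 i a x) (differentiable_matrix.mp hd2 a j x) ?_ ?_
    · simp [graphCoframe_mul_graphFrame]
    · simp [hB]
  have h5 : (fun y => ((graphFrame x.2.1)ᴴ * stratumMap G y * B) i j) = fun y : StratumParams k =>
      (y.1 : ℂ) * ((graphFrame x.2.1)ᴴ * B) i j +
      (∑ a, (graphCoframe y.2.1 * graphFrame x.2.1)ᴴ i a *
        (hermOf y.2.2.1 * (graphCoframe y.2.1 * B)) a j) -
      ((graphFrame x.2.1)ᴴ * G y.2.2.2 * B) i j := by
    funext y
    rw [← Matrix.mul_apply, ← smul_eq_mul, ← Matrix.smul_apply, ← Matrix.add_apply,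
      ← Matrix.sub_apply]
    simp [stratumMap, graphStratum, Matrix.mul_sub, Matrix.sub_mul, Matrix.mul_add, Matrix.add_mul,
      Matrix.mul_assoc]
  rw [h5] at h1
  have h6 := congrArg (fun T : StratumParams k →L[ℝ] ℂ => T d)
    (h1.unique ((h3.fun_add h4).fun_sub h2))
  simpa [hΛ, π] using h6

/-- If the stratum map is a submersion, then the double eigenvalue splits to first order in every
direction. -/
theorem eq_zero_of_surjective_stratumMap (hG : Differentiable ℝ G) (x : StratumParams k)
    (hs : ∀ X : Matrix (Fin 2 ⊕ Fin k) (Fin 2 ⊕ Fin k) ℂ, X.IsHermitian →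
      ∃ d, fderiv ℝ (stratumMap G) x d = X)
    (t : ℝ) (w : Momentum)
    (h : (t : ℂ) • ((graphFrame x.2.1)ᴴ * graphFrame x.2.1) =
      (graphFrame x.2.1)ᴴ * fderiv ℝ G x.2.2.2 w * graphFrame x.2.1) : t = 0 ∧ w = 0 := by
  let F := graphFrame x.2.1
  let R₀ : ℝ × Momentum →ₗ[ℝ] Matrix (Fin 2) (Fin 2) ℂ :=
    { toFun := fun q => (q.1 : ℂ) • (Fᴴ * F) - Fᴴ * fderiv ℝ G x.2.2.2 q.2 * F
      map_add' := fun q q' => by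
        simp only [Prod.fst_add, Prod.snd_add, map_add, Complex.ofReal_add, add_smul,
          Matrix.mul_add, Matrix.add_mul]
        abel
      map_smul' := fun c q => by
        simp only [Prod.smul_fst, Prod.smul_snd, map_smul, Matrix.mul_smul, Matrix.smul_mul,
          RingHom.id_apply, smul_sub, smul_eq_mul, Complex.ofReal_mul, mul_smul,
          Complex.coe_smul] }
  let R : ℝ × Momentum →ₗ[ℝ] (Fin 2 → Fin 2 → ℝ) := realOf.comp R₀
  have hR : Function.Surjective R := by
    intro r
    -- The upper block of the graph frame is `1`, so compression to the graph returns the upper-left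
    -- block `hermOf r`.
    obtain ⟨d, hd⟩ := hs (fromBlocks (hermOf r) 0 0 0) (by
      rw [isHermitian_fromBlocks_iff]
      simp [hermOf_isHermitian])
    refine ⟨(d.1, d.2.2.2), ?_⟩
    have h1 := graphFrame_mul_fderiv_stratumMap_mul hG x d (graphFrame x.2.1)
      (by rw [graphCoframe_mul_graphFrame, sub_self, Matrix.mul_zero])
    change realOf (_ : Matrix (Fin 2) (Fin 2) ℂ) = _
    rw [← realOf_hermOf r]
    congr 1
    refine h1.symm.trans ?_
    rw [hd, graphFrame, conjTranspose_fromRows_eq_fromCols_conjTranspose]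
    simp [fromCols_mul_fromBlocks, fromCols_mul_fromRows]
  -- Both sides have real dimension 4: one for the eigenvalue and three for the momentum, against
  -- the Hermitian 2 × 2 matrices.
  have hinj : Function.Injective R :=
    (LinearMap.injective_iff_surjective_of_finrank_eq_finrank
      (by simp [Module.finrank_pi_fintype])).mpr hR
  have h0 : R (t, w) = R 0 := by
    rw [map_zero]
    change realOf ((t : ℂ) • (Fᴴ * F) - Fᴴ * fderiv ℝ G x.2.2.2 w * F) = 0
    rw [sub_eq_zero.mpr h, map_zero]
  simpa using hinj h0

end Transversality

open Matrix MeasureTheory Module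

/-! ### Generic perturbations by a constant matrix -/

section Generic

variable {N k : ℕ}

/-- Real coordinates of a matrix, after a relabelling of the indices. -/
noncomputable def realOfReindex (e : Fin 2 ⊕ Fin k ≃ Fin N) :
    Matrix (Fin 2 ⊕ Fin k) (Fin 2 ⊕ Fin k) ℂ →L[ℝ] (Fin N → Fin N → ℝ) :=
  LinearMap.toContinuousLinearMap (realOf.comp (reindexLinearEquiv ℝ ℂ e e).toLinearMap)

theorem realOfReindex_apply (e : Fin 2 ⊕ Fin k ≃ Fin N)
    (A : Matrix (Fin 2 ⊕ Fin k) (Fin 2 ⊕ Fin k) ℂ) :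
    realOfReindex e A = realOf (A.submatrix e.symm e.symm) := rfl

theorem eq_of_realOfReindex_eq (e : Fin 2 ⊕ Fin k ≃ Fin N)
    {A B : Matrix (Fin 2 ⊕ Fin k) (Fin 2 ⊕ Fin k) ℂ} (hA : A.IsHermitian) (hB : B.IsHermitian)
    (h : realOfReindex e A = realOfReindex e B) : A = B := by
  have h1 := eq_of_realOf_eq (hA.submatrix e.symm) (hB.submatrix e.symm) h
  have h2 := congrArg (fun M => M.submatrix e e) h1
  simpa using h2

theorem eq_zero_of_isUnit_mul_eq_zero {m : Type*} {T : Matrix (Fin 2) (Fin 2) ℂ}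
    (hT : IsUnit T.det) {M : Matrix (Fin 2) m ℂ} (h : T * M = 0) : M = 0 := by
  have h1 := congrArg (T⁻¹ * ·) h
  simpa [← Matrix.mul_assoc, nonsing_inv_mul _ hT] using h1

/-- The lower block of `(graphCoframe Z)ᴴ` is `1`, so the lower rows of the eigenvector equation are
the claim. -/
theorem mul_graphCoframe_mul_eq_zero {m : ℕ} {l : ℝ} {Z : Matrix (Fin k) (Fin 2) ℂ}
    {P : Matrix (Fin k) (Fin k) ℂ} {B : Matrix (Fin 2 ⊕ Fin k) (Fin m) ℂ}
    (h : graphStratum l Z P * B = (l : ℂ) • B) : P * (graphCoframe Z * B) = 0 := by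
  rw [graphStratum, Matrix.add_mul, Matrix.smul_mul, Matrix.one_mul, add_eq_left, graphCoframe,
    conjTranspose_fromCols_eq_fromRows_conjTranspose, fromRows_mul, fromRows_mul,
    fromRows_mul, ← fromRows_zero, fromRows_ext_iff] at h
  have h2 := h.2
  rwa [conjTranspose_one, Matrix.one_mul, Matrix.mul_assoc] at h2

namespace SmoothFamily

variable (H : SmoothFamily N)

/-- The family `H` after a relabelling of the indices. -/
noncomputable def reindexed (e : Fin 2 ⊕ Fin k ≃ Fin N) (ξ : Momentum) :
    Matrix (Fin 2 ⊕ Fin k) (Fin 2 ⊕ Fin k) ℂ :=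
  (H.toFun ξ).submatrix e e

theorem differentiable_reindexed (e : Fin 2 ⊕ Fin k ≃ Fin N) :
    Differentiable ℝ (H.reindexed e) :=
  differentiable_submatrix (H.smooth.differentiable (by simp)) e e

theorem reindexed_isHermitian (e : Fin 2 ⊕ Fin k ≃ Fin N) (ξ : Momentum) :
    (H.reindexed e ξ).IsHermitian :=
  (H.isHermitian ξ).submatrix e

theorem fderiv_reindexed (e : Fin 2 ⊕ Fin k ≃ Fin N) (ξ v : Momentum) :
    fderiv ℝ (H.reindexed e) ξ v = (fderiv ℝ H.toFun ξ v).submatrix e e := by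
  have h : HasFDerivAt (H.reindexed e)
      ((reindexLinearEquiv ℝ ℂ e.symm e.symm).toLinearMap.toContinuousLinearMap.comp
        (fderiv ℝ H.toFun ξ)) ξ :=
    (LinearMap.toContinuousLinearMap
      (reindexLinearEquiv ℝ ℂ e.symm e.symm).toLinearMap).hasFDerivAt.comp ξ
      (H.smooth.differentiable (by simp) ξ).hasFDerivAt
  rw [h.fderiv]
  rfl

/-- The constant perturbations, in real coordinates, which give the family a matrix with a double
eigenvalue. -/
noncomputable def doubleMap (e : Fin 2 ⊕ Fin k ≃ Fin N) (x : StratumParams k) :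
    Fin N → Fin N → ℝ :=
  realOfReindex e (stratumMap (H.reindexed e) x)

theorem differentiable_doubleMap (e : Fin 2 ⊕ Fin k ≃ Fin N) :
    Differentiable ℝ (H.doubleMap e) :=
  (realOfReindex e).differentiable.comp
    (differentiable_stratumMap (H.differentiable_reindexed e))

/-- The real coordinates are faithful only on Hermitian matrices; the derivative of the stratum map
takes Hermitian values, so equality of coordinates suffices. -/
theorem exists_fderiv_stratumMap_eq (e : Fin 2 ⊕ Fin k ≃ Fin N) {x : StratumParams k}
    (hs : Function.Surjective (fderiv ℝ (H.doubleMap e) x))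
    (X : Matrix (Fin 2 ⊕ Fin k) (Fin 2 ⊕ Fin k) ℂ) (hX : X.IsHermitian) :
    ∃ d, fderiv ℝ (stratumMap (H.reindexed e)) x d = X := by
  have hd := differentiable_stratumMap (H.differentiable_reindexed e) x
  obtain ⟨d, hdX⟩ := hs (realOfReindex e X)
  refine ⟨d, eq_of_realOfReindex_eq e
    (isHermitian_fderiv hd (stratumMap_isHermitian (H.reindexed_isHermitian e)) d) hX ?_⟩
  have h : HasFDerivAt (H.doubleMap e)
      ((realOfReindex e).comp (fderiv ℝ (stratumMap (H.reindexed e)) x)) x :=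
    (realOfReindex e).hasFDerivAt.comp x hd.hasFDerivAt
  rw [← hdX, h.fderiv]
  rfl

/-- A plane of eigenvectors yields a point of the stratum. -/
theorem exists_params {A : Matrix (Fin N) (Fin N) ℂ} (hA : A.IsHermitian)
    {V : Matrix (Fin N) (Fin 2) ℂ} (hV : Vᴴ * V = 1) {l : ℝ} (hVA : A * V = (l : ℂ) • V) :
    ∃ (k : ℕ) (e : Fin 2 ⊕ Fin k ≃ Fin N) (Z : Matrix (Fin k) (Fin 2) ℂ)
      (T : Matrix (Fin 2) (Fin 2) ℂ) (p : Fin k → Fin k → ℝ), IsUnit T.det ∧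
      V.submatrix e id = graphFrame Z * T ∧
      A.submatrix e e = graphStratum l Z (hermOf p) := by
  obtain ⟨k, e, Z, T, hT, hVe⟩ := exists_equiv_eq_graphFrame_mul (eq_zero_of_mulVec_eq_zero hV)
  have hAe : (A.submatrix e e).IsHermitian := hA.submatrix e
  have h1 : A.submatrix e e * graphFrame Z = (l : ℂ) • graphFrame Z := by
    refine mul_eq_smul_of_mul_isUnit hT ?_
    rw [← hVe, submatrix_mul_equiv, hVA]
    rfl
  refine ⟨k, e, Z, T, realOf (A.submatrix e e - (l : ℂ) • 1).toBlocks₂₂, hT, hVe, ?_⟩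
  rw [hermOf_realOf]
  · exact eq_graphStratum hAe h1
  · have h2 : (A.submatrix e e - (l : ℂ) • 1).IsHermitian := hAe.sub (by simp [IsHermitian])
    exact h2.submatrix Sum.inr

theorem doubleMap_eq {r : Fin N → Fin N → ℝ} {ξ : Momentum} {e : Fin 2 ⊕ Fin k ≃ Fin N}
    {P Q : Matrix (Fin 2 ⊕ Fin k) (Fin 2 ⊕ Fin k) ℂ}
    (hP : (H.toFun ξ + hermOf r).submatrix e e = P) (hQ : H.reindexed e ξ = Q) :
    realOfReindex e (P - Q) = r := by
  rw [← hP, ← hQ, realOfReindex_apply]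
  have : ((H.toFun ξ + hermOf r).submatrix e e - H.reindexed e ξ) =
      (hermOf r).submatrix e e := by
    ext i j
    simp [reindexed]
  rw [this]
  simp [realOf_hermOf]

/-- The frame `V` is `graphFrame Z * T` with `T` invertible; cancelling `T` turns flatness into the
relation which forces `v = 0` at a regular point. -/
theorem exists_critical_of_hasFlatDirection {r : Fin N → Fin N → ℝ} {ξ : Momentum}
    (h : HasFlatDirection (H.toFun ξ + hermOf r) (fderiv ℝ H.toFun ξ)) :
    ∃ (k : ℕ) (e : Fin 2 ⊕ Fin k ≃ Fin N),
      r ∈ H.doubleMap e '' {x | ¬ Function.Surjective (fderiv ℝ (H.doubleMap e) x)} := by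
  obtain ⟨V, v, c, d, hV, hVA, hv, hd⟩ := h
  have hA := (H.isHermitian ξ).add (hermOf_isHermitian r)
  obtain ⟨l, rfl⟩ := exists_real_of_mul_eq_smul hA hV hVA (by norm_num)
  obtain ⟨k, e, Z, T, p, hT, hVe, hAe⟩ := exists_params hA hV hVA
  refine ⟨k, e, (l, Z, p, ξ), fun hs => hv ?_, H.doubleMap_eq hAe rfl⟩
  obtain ⟨t, rfl⟩ : ∃ t : ℝ, d = t := by
    have h1 := isHermitian_conjTranspose_mul_mul V (H.fderiv_isHermitian ξ v)
    rw [hd] at h1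
    have h3 := h1.apply 0 0
    simp only [Matrix.smul_apply, one_apply_eq, smul_eq_mul, mul_one] at h3
    exact ⟨d.re, (Complex.conj_eq_iff_re.mp h3).symm⟩
  have hTi : IsUnit T := (isUnit_iff_isUnit_det T).mpr hT
  refine (eq_zero_of_surjective_stratumMap (H.differentiable_reindexed e) (l, Z, p, ξ)
    (H.exists_fderiv_stratumMap_eq e hs) t v ?_).2
  have h1 : Tᴴ * ((t : ℂ) • ((graphFrame Z)ᴴ * graphFrame Z)) * T =
      Tᴴ * ((graphFrame Z)ᴴ * fderiv ℝ (H.reindexed e) ξ v * graphFrame Z) * T := by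
    have h2 : (V.submatrix e id)ᴴ * V.submatrix e id = 1 := by
      rw [conjTranspose_submatrix, submatrix_mul_equiv, hV, submatrix_id_id]
    have h3 : (V.submatrix e id)ᴴ * (fderiv ℝ H.toFun ξ v).submatrix e e * V.submatrix e id =
        (t : ℂ) • 1 := by
      rw [conjTranspose_submatrix, submatrix_mul_equiv, submatrix_mul_equiv, hd, submatrix_id_id]
    rw [← h2, hVe, conjTranspose_mul] at h3
    rw [H.fderiv_reindexed]
    simpa [Matrix.mul_assoc] using h3.symm
  exact ((show IsUnit Tᴴ from hTi.star).mul_left_cancel (hTi.mul_right_cancel h1))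

/-- Let the first two columns of `V` span the plane, let `Y` be the first column and `U` the third.
At a regular point some tangent vector is mapped to `Y Uᴴ + U Yᴴ`. Its compression to the plane is
zero, so its `l` and `ξ` components vanish. The sandwich with `U`, again an eigenvector for `l`,
then gives `Fᴴ Y = 0`, although `Y ≠ 0` lies in the plane. -/
theorem exists_critical_of_hasTripleEigenvalue {r : Fin N → Fin N → ℝ} {ξ : Momentum}
    (h : HasTripleEigenvalue (H.toFun ξ + hermOf r)) :
    ∃ (k : ℕ) (e : Fin 2 ⊕ Fin k ≃ Fin N),
      r ∈ H.doubleMap e '' {x | ¬ Function.Surjective (fderiv ℝ (H.doubleMap e) x)} := by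
  obtain ⟨V, c, hV, hVA⟩ := h
  have hA := (H.isHermitian ξ).add (hermOf_isHermitian r)
  obtain ⟨l, rfl⟩ := exists_real_of_mul_eq_smul hA hV hVA (by norm_num)
  have hsub : ∀ {m n : ℕ} (f : Fin m → Fin 3) (g : Fin n → Fin 3),
      (V.submatrix id f)ᴴ * V.submatrix id g = (1 : Matrix (Fin 3) (Fin 3) ℂ).submatrix f g := by
    intro m n f g
    rw [conjTranspose_submatrix, ← submatrix_mul _ _ _ _ _ Function.bijective_id, hV]
  have hsubA : ∀ {m : ℕ} (f : Fin m → Fin 3), (H.toFun ξ + hermOf r) * V.submatrix id f =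
      (l : ℂ) • V.submatrix id f := by
    intro m f
    rw [← submatrix_id_id (H.toFun ξ + hermOf r),
      ← submatrix_mul _ _ _ _ _ Function.bijective_id, hVA]
    rfl
  have hV' : (V.submatrix id (Fin.castSucc : Fin 2 → Fin 3))ᴴ *
      V.submatrix id (Fin.castSucc : Fin 2 → Fin 3) = 1 := by
    rw [hsub, submatrix_one _ (Fin.castSucc_injective 2)]
  obtain ⟨k, e, Z, T, p, hT, hVe, hAe⟩ := exists_params hA hV' (hsubA _)
  refine ⟨k, e, (l, Z, p, ξ), fun hs => ?_, H.doubleMap_eq hAe rfl⟩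
  have hTd : IsUnit (Tᴴ).det := (isUnit_iff_isUnit_det _).mp
    (show IsUnit Tᴴ from ((isUnit_iff_isUnit_det T).mpr hT).star)
  set U : Matrix (Fin 2 ⊕ Fin k) (Fin 1) ℂ := V.submatrix e fun _ => 2 with hU
  set Y : Matrix (Fin 2 ⊕ Fin k) (Fin 1) ℂ := V.submatrix e fun _ => 0 with hY
  have hVsub : ∀ {m n : ℕ} (f : Fin m → Fin 3) (g : Fin n → Fin 3),
      (V.submatrix e f)ᴴ * V.submatrix e g = (1 : Matrix (Fin 3) (Fin 3) ℂ).submatrix f g := by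
    intro m n f g
    rw [conjTranspose_submatrix, submatrix_mul_equiv, hV]
  have hVe' : V.submatrix e (Fin.castSucc : Fin 2 → Fin 3) = graphFrame Z * T := hVe
  have hFU : (graphFrame Z)ᴴ * U = 0 := by
    have h1 := hVsub (Fin.castSucc : Fin 2 → Fin 3) (fun _ : Fin 1 => 2)
    rw [hVe', conjTranspose_mul, Matrix.mul_assoc] at h1
    refine eq_zero_of_isUnit_mul_eq_zero hTd (h1.trans ?_)
    ext i j
    fin_cases i <;> simp
  have hUU : Uᴴ * U = 1 := by
    rw [hU, hVsub]
    ext i j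
    simp [Matrix.one_apply, Subsingleton.elim i j]
  have hUF : Uᴴ * graphFrame Z = 0 := by
    rw [← conjTranspose_conjTranspose (graphFrame Z), ← conjTranspose_mul, hFU,
      conjTranspose_zero]
  have hYU : Yᴴ * U = 0 := by
    rw [hU, hY, hVsub]
    ext i j
    simp
  have hCU : hermOf p * (graphCoframe Z * U) = 0 := by
    refine mul_graphCoframe_mul_eq_zero (l := l) ?_
    rw [← hAe, hU, submatrix_mul_equiv, hVA]
    rfl
  have hH := H.differentiable_reindexed e
  have hs' := H.exists_fderiv_stratumMap_eq e hs
  obtain ⟨d, hd⟩ := hs' (Y * Uᴴ + U * Yᴴ) (by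
    rw [IsHermitian, conjTranspose_add, conjTranspose_mul, conjTranspose_mul,
      conjTranspose_conjTranspose, conjTranspose_conjTranspose, add_comm])
  have h1 := graphFrame_mul_fderiv_stratumMap_mul hH (l, Z, p, ξ) d (graphFrame Z)
    (by rw [graphCoframe_mul_graphFrame, sub_self, Matrix.mul_zero])
  have h2 := graphFrame_mul_fderiv_stratumMap_mul hH (l, Z, p, ξ) d U hCU
  have h3 : (graphFrame Z)ᴴ * (Y * Uᴴ + U * Yᴴ) * graphFrame Z = 0 := by
    rw [Matrix.mul_add, ← Matrix.mul_assoc _ U, hFU, Matrix.zero_mul, add_zero, Matrix.mul_assoc,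
      Matrix.mul_assoc, hUF, Matrix.mul_zero, Matrix.mul_zero]
  have h4 : (graphFrame Z)ᴴ * (Y * Uᴴ + U * Yᴴ) * U = (graphFrame Z)ᴴ * Y := by
    rw [Matrix.mul_assoc, Matrix.add_mul, Matrix.mul_assoc, hUU, Matrix.mul_assoc, hYU,
      Matrix.mul_one, Matrix.mul_zero, add_zero]
  dsimp only at h1 h2
  rw [hd, h3] at h1
  obtain ⟨h5, h6⟩ := eq_zero_of_surjective_stratumMap hH (l, Z, p, ξ) hs' d.1 d.2.2.2
    (sub_eq_zero.mp h1.symm)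
  rw [hd, h4, h5, h6, map_zero] at h2
  simp only [Complex.ofReal_zero, zero_smul, Matrix.mul_zero, Matrix.zero_mul, sub_self] at h2
  have h7 := hVsub (Fin.castSucc : Fin 2 → Fin 3) (fun _ : Fin 1 => 0)
  rw [hVe', conjTranspose_mul, Matrix.mul_assoc, ← hY, h2, Matrix.mul_zero] at h7
  have h8 : (0 : ℂ) = (1 : Matrix (Fin 3) (Fin 3) ℂ) 0 0 := congrFun (congrFun h7 0) 0
  simp at h8

/-- Parameters `(l, Z, ξ, δ, Z', p)` for a Hermitian matrix with two double eigenvalues and a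
quasi-momentum. -/
abbrev TwoDoubleParams (k k' : ℕ) : Type :=
  ℝ × Matrix (Fin k) (Fin 2) ℂ × Momentum × ℝ × Matrix (Fin k') (Fin 2) ℂ ×
    (Fin k' → Fin k' → ℝ)

/-- The constant perturbations, in real coordinates, which give the family a matrix with two double
eigenvalues. -/
noncomputable def twoDoubleMap {k k' : ℕ} (e : Fin 2 ⊕ Fin k ≃ Fin N)
    (e' : Fin 2 ⊕ Fin k' ≃ Fin k) (x : TwoDoubleParams k k') : Fin N → Fin N → ℝ :=
  realOfReindex e (graphStratum x.1 x.2.1 ((x.2.2.2.1 : ℂ) • (1 + x.2.1 * x.2.1ᴴ)⁻¹ +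
    (graphStratum 0 x.2.2.2.2.1 (hermOf x.2.2.2.2.2)).submatrix e'.symm e'.symm) -
      H.reindexed e x.2.2.1)

open scoped ComplexOrder in
theorem isUnit_det_one_add_mul_conjTranspose {k : ℕ} (Z : Matrix (Fin k) (Fin 2) ℂ) :
    IsUnit (1 + Z * Zᴴ).det :=
  (isUnit_iff_isUnit_det _).mp
    (PosDef.one.add_posSemidef (posSemidef_self_mul_conjTranspose Z)).isUnit

theorem differentiable_matrix_inv {E : Type*} [NormedAddCommGroup E] [NormedSpace ℝ E] {k : ℕ}
    {F : E → Matrix (Fin k) (Fin k) ℂ} (hF : Differentiable ℝ F) (h : ∀ x, IsUnit (F x).det) :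
    Differentiable ℝ fun x => (F x)⁻¹ := by
  have hdet : ∀ {G : E → Matrix (Fin k) (Fin k) ℂ}, Differentiable ℝ G →
      Differentiable ℝ fun x => (G x).det := by
    intro G hG
    simp only [det_apply]
    refine Differentiable.fun_sum fun σ _ => Differentiable.const_smul ?_ _
    exact fun x => (HasFDerivAt.finsetProd fun i _ =>
      (differentiable_matrix.mp hG (σ i) i x).hasFDerivAt).differentiableAt
  refine differentiable_matrix.mpr fun i j => ?_
  -- Cramer's rule: the entries of the inverse are quotients of determinants.
  simp only [inv_def, Matrix.smul_apply, adjugate_apply, smul_eq_mul, Ring.inverse_eq_inv']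
  refine ((hdet hF).inv fun x => (h x).ne_zero).mul (hdet ?_)
  refine differentiable_matrix.mpr fun a b => ?_
  by_cases hb : a = j
  · subst hb
    simp only [updateRow_self]
    exact differentiable_const _
  · simp only [updateRow_ne hb]
    exact differentiable_matrix.mp hF a b

theorem differentiable_twoDoubleMap {k k' : ℕ} (e : Fin 2 ⊕ Fin k ≃ Fin N)
    (e' : Fin 2 ⊕ Fin k' ≃ Fin k) : Differentiable ℝ (H.twoDoubleMap e e') := by
  have hZ : Differentiable ℝ fun x : TwoDoubleParams k k' => x.2.1 := differentiable_snd.fst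
  refine (realOfReindex e).differentiable.comp (Differentiable.sub (differentiable_graphStratum
    differentiable_fst hZ (Differentiable.add ?_ (differentiable_submatrix
    (differentiable_graphStratum (differentiable_const 0) ?_ (differentiable_hermOf ?_)) _ _)))
    ((H.differentiable_reindexed e).comp differentiable_snd.snd.fst))
  · refine Differentiable.smul
      (Complex.ofRealCLM.differentiable.comp differentiable_snd.snd.snd.fst)
      (differentiable_matrix_inv ((differentiable_const _).add (differentiable_matrix_mul hZ
        (differentiable_conjTranspose hZ))) fun x => isUnit_det_one_add_mul_conjTranspose _)
  · exact differentiable_snd.snd.snd.snd.fst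
  · exact differentiable_snd.snd.snd.snd.snd

/-- A second plane orthogonal to the graph of `Z` has the frame `[-Zᴴ t; t]`, and the coframe maps
it to `G t` with `G = 1 + Z Zᴴ`. The eigenvalue equation for `l'` becomes `P G t = (l' - l) t`, so
the Hermitian matrix `P - (l' - l) G⁻¹` kills the plane `G t` and lies in a stratum of smaller size
with eigenvalue 0. This explains the inverse in `twoDoubleMap`. -/
theorem exists_mem_range_of_hasTwoDoubleEigenvalues {r : Fin N → Fin N → ℝ} {ξ : Momentum}
    (h : HasTwoDoubleEigenvalues (H.toFun ξ + hermOf r)) :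
    ∃ (k k' : ℕ) (e : Fin 2 ⊕ Fin k ≃ Fin N) (e' : Fin 2 ⊕ Fin k' ≃ Fin k),
      r ∈ Set.range (H.twoDoubleMap e e') := by
  obtain ⟨V, W, c, c', hV, hW, hVW, hVA, hWA⟩ := h
  have hA := (H.isHermitian ξ).add (hermOf_isHermitian r)
  obtain ⟨l, rfl⟩ := exists_real_of_mul_eq_smul hA hV hVA (by norm_num)
  obtain ⟨l', rfl⟩ := exists_real_of_mul_eq_smul hA hW hWA (by norm_num)
  obtain ⟨k, e, Z, T, p, hT, hVe, hAe⟩ := exists_params hA hV hVA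
  have hTd : IsUnit (Tᴴ).det := (isUnit_iff_isUnit_det _).mp
    (show IsUnit Tᴴ from ((isUnit_iff_isUnit_det T).mpr hT).star)
  set P := hermOf p with hP
  set G : Matrix (Fin k) (Fin k) ℂ := 1 + Z * Zᴴ with hG
  have hGd : IsUnit G.det := isUnit_det_one_add_mul_conjTranspose Z
  have hGh : G.IsHermitian := isHermitian_one.add (isHermitian_mul_conjTranspose_self Z)
  obtain ⟨a, t, hat⟩ : ∃ (a : Matrix (Fin 2) (Fin 2) ℂ) (t : Matrix (Fin k) (Fin 2) ℂ),
      W.submatrix e id = fromRows a t := ⟨_, _, (fromRows_toRows _).symm⟩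
  have hFW : (graphFrame Z)ᴴ * W.submatrix e id = 0 := by
    refine eq_zero_of_isUnit_mul_eq_zero hTd ?_
    rw [← Matrix.mul_assoc, ← conjTranspose_mul, ← hVe, conjTranspose_submatrix,
      submatrix_mul_equiv, hVW]
    rfl
  have ha : a = -(Zᴴ * t) := by
    rw [hat, graphFrame, conjTranspose_fromRows_eq_fromCols_conjTranspose, fromCols_mul_fromRows,
      conjTranspose_one, Matrix.one_mul] at hFW
    exact eq_neg_of_add_eq_zero_left hFW
  have hCW : graphCoframe Z * fromRows a t = G * t := by
    rw [graphCoframe, fromCols_mul_fromRows, ha, hG, Matrix.add_mul, Matrix.one_mul,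
      Matrix.neg_mul, Matrix.mul_neg, neg_neg, add_comm, Matrix.mul_assoc]
  have hPG : P * (G * t) = ((l' - l : ℝ) : ℂ) • t := by
    have h1 : graphStratum l Z P * fromRows a t = (l' : ℂ) • fromRows a t := by
      rw [← hAe, ← hat, submatrix_mul_equiv, hWA]
      rfl
    rw [graphStratum, Matrix.add_mul, Matrix.smul_mul, Matrix.one_mul, Matrix.mul_assoc, hCW,
      graphCoframe, conjTranspose_fromCols_eq_fromRows_conjTranspose, fromRows_mul,
      fromRows_mul] at h1
    have h2 := congrArg toRows₂ h1
    ext i j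
    have h3 := congrFun (congrFun h2 i) j
    simp only [toRows₂_apply, Matrix.add_apply, Matrix.smul_apply, fromRows_apply_inr,
      conjTranspose_one, Matrix.one_mul, Matrix.mul_assoc] at h3
    rw [Matrix.smul_apply, Complex.ofReal_sub, sub_smul, ← h3]
    simp
  have ht : ∀ c, (G * t) *ᵥ c = 0 → c = 0 := by
    intro c hc
    have h1 : t *ᵥ c = 0 := by
      have h2 := congrArg (G⁻¹ *ᵥ ·) hc
      simpa [mulVec_mulVec, ← Matrix.mul_assoc, nonsing_inv_mul _ hGd] using h2
    have h2 : a *ᵥ c = 0 := by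
      rw [ha, neg_mulVec, ← mulVec_mulVec, h1, mulVec_zero, neg_zero]
    have h3 : (W.submatrix e id) *ᵥ c = 0 := by
      rw [hat, fromRows_mulVec, h1, h2]
      ext (i | i) <;> rfl
    refine eq_zero_of_mulVec_eq_zero hW c (funext fun i => ?_)
    have h4 := congrFun h3 (e.symm i)
    simpa [mulVec, dotProduct] using h4
  obtain ⟨k', e', Z', T', hT', hGe⟩ := exists_equiv_eq_graphFrame_mul ht
  set B := P - ((l' - l : ℝ) : ℂ) • G⁻¹ with hB
  have hBh : B.IsHermitian := by
    refine (hermOf_isHermitian p).sub ?_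
    rw [IsHermitian, conjTranspose_smul, hGh.inv.eq, Complex.star_def, Complex.conj_ofReal]
  have hBt : B * (G * t) = 0 := by
    rw [hB, Matrix.sub_mul, hPG, Matrix.smul_mul, ← Matrix.mul_assoc, nonsing_inv_mul _ hGd,
      Matrix.one_mul, sub_self]
  have hBe : B.submatrix e' e' * graphFrame Z' = ((0 : ℝ) : ℂ) • graphFrame Z' := by
    refine mul_eq_smul_of_mul_isUnit hT' ?_
    rw [← hGe, submatrix_mul_equiv, hBt]
    simp
  obtain ⟨p', hp'⟩ : ∃ p', B.submatrix e' e' = graphStratum 0 Z' (hermOf p') := by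
    refine ⟨realOf (B.submatrix e' e' - ((0 : ℝ) : ℂ) • 1).toBlocks₂₂, ?_⟩
    rw [hermOf_realOf]
    · exact eq_graphStratum (hBh.submatrix e') hBe
    · simpa using! (hBh.submatrix e').submatrix Sum.inr
  have hPB : P = ((l' - l : ℝ) : ℂ) • G⁻¹ +
      (graphStratum 0 Z' (hermOf p')).submatrix e'.symm e'.symm := by
    rw [← hp', submatrix_submatrix, e'.self_comp_symm, submatrix_id_id, hB, add_sub_cancel]
  exact ⟨k, k', e, e', (l, Z, ξ, l' - l, Z', p'),
    H.doubleMap_eq (hAe.trans (congrArg (graphStratum l Z) hPB)) rfl⟩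

theorem finiteDimensional_twoDoubleParams {k k' : ℕ} :
    FiniteDimensional ℝ (TwoDoubleParams k k') := by
  have h1 : FiniteDimensional ℝ (Matrix (Fin k') (Fin 2) ℂ × (Fin k' → Fin k' → ℝ)) :=
    inferInstance
  have h2 : FiniteDimensional ℝ (Matrix (Fin k) (Fin 2) ℂ) := inferInstance
  have h3 : FiniteDimensional ℝ (Momentum × ℝ × Matrix (Fin k') (Fin 2) ℂ ×
    (Fin k' → Fin k' → ℝ)) := Module.Finite.prod
  unfold TwoDoubleParams
  exact Module.Finite.prod

theorem finrank_twoDoubleParams {k k' : ℕ} :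
    Module.finrank ℝ (TwoDoubleParams k k') = 5 + 4 * k + 4 * k' + k' * k' := by
  have h1 : Module.finrank ℝ (Matrix (Fin k') (Fin 2) ℂ × (Fin k' → Fin k' → ℝ)) =
    4 * k' + k' * k' := by
    simp [Module.finrank_pi_fintype, Module.finrank_matrix]
    ring
  have h2 : Module.finrank ℝ (Matrix (Fin k) (Fin 2) ℂ) = 4 * k := by
    simp [Module.finrank_matrix]
    ring
  have h3 : Module.finrank ℝ (Momentum × ℝ × Matrix (Fin k') (Fin 2) ℂ ×
      (Fin k' → Fin k' → ℝ)) = 4 + 4 * k' + k' * k' := by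
    rw [Module.finrank_prod, Module.finrank_prod, h1]
    simp
    ring
  have h4 : FiniteDimensional ℝ (ℝ × Matrix (Fin k') (Fin 2) ℂ ×
    (Fin k' → Fin k' → ℝ)) := inferInstance
  rw [Module.finrank_prod, Module.finrank_prod, h2, h3]
  simp
  ring

/-- There are countably many charts. For `N = k + 2` the source of `doubleMap` has dimension `1 + 4k
+ k² + 3 = N²`, so Sard's theorem applies. For `N = k' + 4` that of `twoDoubleMap` has dimension `N²
- 3`, so its range is null. -/
theorem measure_badPerturbation (μ : Measure (Fin N → Fin N → ℝ)) [μ.IsAddHaarMeasure] :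
    μ {r | ∃ ξ, IsBadJet (H.toFun ξ + hermOf r) (fderiv ℝ H.toFun ξ)} = 0 := by
  have h1 : μ (⋃ (k : ℕ) (e : Fin 2 ⊕ Fin k ≃ Fin N), H.doubleMap e ''
      {x | ¬ Function.Surjective (fderiv ℝ (H.doubleMap e) x)}) = 0 := by
    refine measure_iUnion_null fun k => measure_iUnion_null fun e =>
      measure_criticalValues_eq_zero μ (le_of_eq ?_) (H.differentiable_doubleMap e)
    have hN : 2 + k = N := by simpa using Fintype.card_congr e
    simp [Module.finrank_pi_fintype, Module.finrank_matrix, ← hN]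
    ring
  have h2 : μ (⋃ (k : ℕ) (k' : ℕ) (e : Fin 2 ⊕ Fin k ≃ Fin N) (e' : Fin 2 ⊕ Fin k' ≃ Fin k),
      Set.range (H.twoDoubleMap e e')) = 0 := by
    refine measure_iUnion_null fun k => measure_iUnion_null fun k' => measure_iUnion_null fun e =>
      measure_iUnion_null fun e' =>
      have := finiteDimensional_twoDoubleParams (k := k) (k' := k')
      measure_range_eq_zero μ ?_ (H.differentiable_twoDoubleMap e e')
    have hN : 2 + k = N := by simpa using Fintype.card_congr e
    have hk : 2 + k' = k := by simpa using Fintype.card_congr e'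
    rw [finrank_twoDoubleParams]
    simp [Module.finrank_pi_fintype, ← hN, ← hk]
    nlinarith
  refine measure_mono_null ?_ (measure_union_null h1 h2)
  rintro r ⟨ξ, h | h | h⟩
  · obtain ⟨k, e, hr⟩ := H.exists_critical_of_hasTripleEigenvalue h
    exact Or.inl (Set.mem_iUnion₂.mpr ⟨k, e, hr⟩)
  · obtain ⟨k, k', e, e', hr⟩ := H.exists_mem_range_of_hasTwoDoubleEigenvalues h
    exact Or.inr (Set.mem_iUnion₂.mpr ⟨k, k', Set.mem_iUnion₂.mpr ⟨e, e', hr⟩⟩)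
  · obtain ⟨k, e, hr⟩ := H.exists_critical_of_hasFlatDirection h
    exact Or.inl (Set.mem_iUnion₂.mpr ⟨k, e, hr⟩)

end SmoothFamily

end Generic

open Matrix MeasureTheory

/-! ### Density of the Hamiltonians with conical degeneracies -/

section Density

variable {N : ℕ}

theorem norm_entry_le_frobenius_norm {m n : Type*} [Fintype m] [Fintype n] (A : Matrix m n ℂ)
    (i : m) (j : n) : ‖A i j‖ ≤ ‖A‖ := by
  rw [frobenius_norm_def, ← Real.sqrt_eq_rpow]
  refine Real.le_sqrt_of_sq_le ?_
  have h1 : ‖A i j‖ ^ (2 : ℝ) ≤ ∑ b, ‖A i b‖ ^ (2 : ℝ) :=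
    Finset.single_le_sum (f := fun b => ‖A i b‖ ^ (2 : ℝ)) (fun _ _ => by positivity)
      (Finset.mem_univ j)
  have h2 : ∑ b, ‖A i b‖ ^ (2 : ℝ) ≤ ∑ a, ∑ b, ‖A a b‖ ^ (2 : ℝ) :=
    Finset.single_le_sum (f := fun a => ∑ b, ‖A a b‖ ^ (2 : ℝ)) (fun _ _ => by positivity)
      (Finset.mem_univ i)
  simpa using h1.trans h2

theorem norm_phase (ξ : Momentum) (k : Fin 3 → ℤ) : ‖phase ξ k‖ = 1 := by
  rw [phase, mul_comm]
  exact Complex.norm_exp_ofReal_mul_I _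

theorem phase_zero (ξ : Momentum) : phase ξ 0 = 1 := by simp [phase]

/-- The operator which acts on the internal degrees of freedom of each site by the matrix `M`. -/
noncomputable def onsite (M : Matrix (Fin N) (Fin N) ℂ) : StateSpace N →L[ℂ] StateSpace N :=
  lp.mapCLM 2 (fun _ => toEuclideanCLM (𝕜 := ℂ) M)
    (norm_nonneg (toEuclideanCLM (𝕜 := ℂ) M)) fun _ => le_rfl

theorem onsite_apply (M : Matrix (Fin N) (Fin N) ℂ) (ψ : StateSpace N) (m : Fin 3 → ℤ) :
    onsite M ψ m = toEuclideanCLM (𝕜 := ℂ) M (ψ m) :=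
  rfl

theorem isSelfAdjoint_onsite {M : Matrix (Fin N) (Fin N) ℂ} (hM : M.IsHermitian) :
    IsSelfAdjoint (onsite M) := by
  have h := isSymmetric_toEuclideanLin_iff.mpr hM
  refine ContinuousLinearMap.isSelfAdjoint_iff_isSymmetric.mpr fun ψ φ => ?_
  simp only [ContinuousLinearMap.coe_coe, lp.inner_eq_tsum, onsite_apply]
  exact tsum_congr fun m => h (ψ m) (φ m)

theorem onsite_translation (M : Matrix (Fin N) (Fin N) ℂ) (a : Fin 3 → ℤ) (ψ : StateSpace N) :
    onsite M (translation a ψ) = translation a (onsite M ψ) :=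
  rfl

theorem kernel_onsite_zero (M : Matrix (Fin N) (Fin N) ℂ) : kernel (onsite M) 0 0 = M := by
  ext i j
  simp [kernel, onsite_apply, ofLp_toEuclideanCLM]

theorem kernel_onsite_of_ne (M : Matrix (Fin N) (Fin N) ℂ) {k : Fin 3 → ℤ} (hk : k ≠ 0) :
    kernel (onsite M) 0 k = 0 := by
  ext i j
  simp only [kernel, of_apply, onsite_apply]
  rw [lp.single_apply_ne _ _ _ hk.symm]
  simp

theorem kernel_add_op (S T : StateSpace N →L[ℂ] StateSpace N) (m k : Fin 3 → ℤ) :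
    kernel (S + T) m k = kernel S m k + kernel T m k :=
  rfl

theorem summable_norm_kernel_onsite (M : Matrix (Fin N) (Fin N) ℂ) :
    Summable fun k : Fin 3 → ℤ => ‖kernel (onsite M) 0 k‖ :=
  summable_of_ne_finset_zero (s := {0}) fun k hk => by
    rw [kernel_onsite_of_ne M (by simpa using hk), norm_zero]

theorem blochMatrix_onsite (M : Matrix (Fin N) (Fin N) ℂ) (ξ : Momentum) :
    blochMatrix (onsite M) ξ = M := by
  ext i j
  rw [blochMatrix, of_apply, tsum_eq_single 0, kernel_onsite_zero, phase_zero, mul_one]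
  intro k hk
  rw [kernel_onsite_of_ne M hk, Matrix.zero_apply, zero_mul]

theorem summable_kernel_mul_phase {S : StateSpace N →L[ℂ] StateSpace N}
    (hS : Summable fun k : Fin 3 → ℤ => ‖kernel S 0 k‖) (ξ : Momentum) (i j : Fin N) :
    Summable fun k : Fin 3 → ℤ => kernel S 0 k i j * phase ξ k :=
  hS.of_norm_bounded fun k => by
    rw [norm_mul, norm_phase, mul_one]
    exact norm_entry_le_frobenius_norm _ i j

theorem blochMatrix_add {S T : StateSpace N →L[ℂ] StateSpace N}
    (hS : Summable fun k : Fin 3 → ℤ => ‖kernel S 0 k‖)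
    (hT : Summable fun k : Fin 3 → ℤ => ‖kernel T 0 k‖) (ξ : Momentum) :
    blochMatrix (S + T) ξ = blochMatrix S ξ + blochMatrix T ξ := by
  ext i j
  simp only [blochMatrix, of_apply, Matrix.add_apply, kernel_add_op, add_mul]
  exact (summable_kernel_mul_phase hS ξ i j).tsum_add (summable_kernel_mul_phase hT ξ i j)

namespace Hamiltonian

theorem blochMatrix_op_add_onsite (A : Hamiltonian N) (M : Matrix (Fin N) (Fin N) ℂ) :
    blochMatrix (A.op + onsite M) = fun ξ => blochMatrix A.op ξ + M := by
  funext ξ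
  rw [blochMatrix_add A.summable (summable_norm_kernel_onsite M), blochMatrix_onsite]

/-- The Hamiltonian `A` perturbed by a Hermitian matrix acting on each site. -/
noncomputable def perturb (A : Hamiltonian N) {M : Matrix (Fin N) (Fin N) ℂ}
    (hM : M.IsHermitian) : Hamiltonian N where
  op := A.op + onsite M
  selfAdjoint := A.selfAdjoint.add (isSelfAdjoint_onsite hM)
  invariant a ψ := by
    rw [_root_.add_apply, A.invariant, onsite_translation]
    rfl
  summable := (A.summable.add (summable_norm_kernel_onsite M)).of_nonneg_of_le
    (fun _ => norm_nonneg _) fun _ => norm_add_le _ _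
  smooth := by
    rw [blochMatrix_op_add_onsite]
    exact A.smooth.add contDiff_const

theorem bloch_perturb (A : Hamiltonian N) {M : Matrix (Fin N) (Fin N) ℂ} (hM : M.IsHermitian) :
    (A.perturb hM).bloch.toFun = fun ξ => A.bloch.toFun ξ + M :=
  A.blochMatrix_op_add_onsite M

end Hamiltonian

theorem SmoothFamily.cNorm_const_le (k : ℕ) (M : Matrix (Fin N) (Fin N) ℂ) :
    SmoothFamily.cNorm k (fun _ => M) ≤ 2 * ‖M‖ := by
  refine ciSup_le fun ξ => ?_
  rcases eq_or_ne k 0 with rfl | hk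
  -- For `k = 0` the norm counts `‖M‖` twice.
  · rw [norm_iteratedFDeriv_zero, two_mul]
  · rw [iteratedFDeriv_const_of_ne hk, Pi.zero_apply, norm_zero, add_zero]
    linarith [norm_nonneg M]

theorem Hamiltonian.dist_perturb_le (A : Hamiltonian N) {M : Matrix (Fin N) (Fin N) ℂ}
    (hM : M.IsHermitian) : dist (A.perturb hM) A ≤ 4 * ‖M‖ := by
  have h : (A.perturb hM).bloch.toFun - A.bloch.toFun = fun _ => M := by
    rw [bloch_perturb]
    funext ξ
    exact add_sub_cancel_left _ _
  have h1 := SmoothFamily.summable_distance (A.perturb hM).bloch A.bloch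
  -- The constant 4 is the bound 2 for each norm times the sum 2 of the weights.
  have h2 : HasSum (fun k : ℕ => (1 / 2 : ℝ) ^ k * (2 * ‖M‖)) (2 * (2 * ‖M‖)) :=
    hasSum_geometric_two.mul_right _
  change SmoothFamily.distance _ _ ≤ _
  rw [SmoothFamily.distance, show 4 * ‖M‖ = 2 * (2 * ‖M‖) by ring, ← h2.tsum_eq]
  refine h1.tsum_le_tsum (fun k => ?_) h2.summable
  refine mul_le_mul_of_nonneg_left ?_ (by positivity)
  have h3 := SmoothFamily.cNorm_nonneg k fun _ : Momentum => M
  rw [h]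
  exact (div_le_self h3 (by linarith)).trans (SmoothFamily.cNorm_const_le k M)

theorem dense_hasOnlyConicalDegeneracies (N : ℕ) :
    Dense {A : Hamiltonian N | A.HasOnlyConicalDegeneracies} := by
  refine Metric.dense_iff.mpr fun A ε hε => ?_
  -- The complement of a null set is dense, so it meets the open set of those `r` whose perturbation
  -- moves `A` by less than `ε`.
  have hd := Measure.dense_of_ae
    (measure_eq_zero_iff_ae_notMem.mp (A.bloch.measure_badPerturbation Measure.addHaar))
  have hc : Continuous (hermOf : (Fin N → Fin N → ℝ) →ₗ[ℝ] Matrix (Fin N) (Fin N) ℂ) :=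
    LinearMap.continuous_of_finiteDimensional _
  have ho : IsOpen {r : Fin N → Fin N → ℝ | 4 * ‖hermOf r‖ < ε} :=
    isOpen_lt (continuous_const.mul hc.norm) continuous_const
  obtain ⟨r, hr, hrε⟩ := hd.inter_open_nonempty _ ho ⟨0, by simpa using hε⟩
  refine ⟨A.perturb (hermOf_isHermitian r), (A.dist_perturb_le _).trans_lt hr,
    (A.perturb _).hasOnlyConicalDegeneracies_iff.mpr fun ξ hξ => hrε ⟨ξ, ?_⟩⟩
  rwa [A.bloch_perturb, fderiv_add_const] at hξ

end Density

end BlochTheory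

theorem mainTheorem4 (N : ℕ) :
    IsOpen {A : BlochTheory.Hamiltonian N | A.HasOnlyConicalDegeneracies} ∧
      Dense {A : BlochTheory.Hamiltonian N | A.HasOnlyConicalDegeneracies} := by
  exact ⟨BlochTheory.isOpen_hasOnlyConicalDegeneracies N,
    BlochTheory.dense_hasOnlyConicalDegeneracies N⟩
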